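/- **Setting.** Let $f(\mathbf x)=\mathbb E_{\boldsymbol\xi}[f(\mathbf x;\boldsymbol\xi)]$ on $\mathbb R^d$, where for every value of $\boldsymbol\xi$ the function $f(\cdot;\boldsymbol\xi)$ is differentiable with $L_g$-Lipschitz gradient, $L_g>0$ (A1), and is $L_c$-Lipschitz (A3), both with respect to the Euclidean norm. Unconstrained ZO-AdaMM starts from $\mathbf x_1\in\mathbb R^d$, $\mathbf m_0=\mathbf v_0=\mathbf 0$ and $\hat{\mathbf v}_0$, and computes for $t=1,\dots,T$ (all vector operations coordinatewise) $$\hat{\mathbf g}_t=\tfrac d\mu\,[f(\mathbf x_t+\mu\mathbf u_t;\boldsymbol\xi_t)-f(\mathbf x_t;\boldsymbol\xi_t)]\,\mathbf u_t,\quad \mathbf m_t=\beta_1\mathbf m_{t-1}+(1-\beta_1)\hat{\mathbf g}_t,\quad \mathbf v_t=\beta_2\mathbf v_{t-1}+(1-\beta_2)\hat{\mathbf g}_t^2,$$ $$\hat{\mathbf v}_t=\max(\hat{\mathbf v}_{t-1},\mathbf v_t),\quad \hat{\mathbf V}_t=\mathrm{diag}(\hat{\mathbf v}_t),\quad \mathbf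 x_{t+1}=\mathbf x_t-\alpha_t\hat{\mathbf V}_t^{-1/2}\mathbf m_t,$$ where the $\boldsymbol\xi_t$ are copies of $\boldsymbol\xi$, the $\mathbf u_t$ are uniform on the unit sphere of $\mathbb R^d$, and all of them are independent. Let $R$ be uniform on $\{1,\dots,T\}$ and independent of all $\boldsymbol\xi_t,\mathbf u_t$. Let $f_\mu(\mathbf x)=\mathbb E[f(\mathbf x+\mu\mathbf u)]$ with $\mathbf u$ uniform on the unit ball. **Theorem.** Let $L_g>0$, $L_c\ge 0$, $c>0$, $D_f\in\mathbb R$, $\beta_1\ge 0$ and $0<\beta_2\le 1$ with $\beta_1/\beta_2<1$. There is a constant $C$, depending only on $L_g,L_c,c,D_f,\beta_1,\beta_2$, such that the following holds for all $d,T\ge1$ with $\max\{d,T\}\ge 3$. Suppose that A1 and A3 hold, $\mu=\alpha_t=1/\sqrt{Td}$, $\hat{\mathbf v}_0^{1/2}\ge c\mathbf 1$ coordinatewise, and $f_\mu(\mathbf x_1)-f_\mu(\mathbf x)\le D_f$ for all $\mathbf x$. Put $\delta=1/(T\sqrt d)$ and let $U$ be the event $$\max_{1\le t\le T}\|\hat{\mathbf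 g}_t\|_\infty\le 2L_c\sqrt{d\log(dT/\delta)}.$$ Then $\mathbb P(U)\ge 1-\frac1{T\sqrt d}$, and, conditionally on $U$, $$\mathbb E\left[\left\|\hat{\mathbf V}_R^{-1/4}\nabla f(\mathbf x_R)\right\|^2\;\middle|\;U\right]\le C\left(\frac{\sqrt d}{\sqrt T}+\frac{d^{1.5}}{T}\right),$$ where the random variable on the left is integrable. -/

import Mathlib

open MeasureTheory ProbabilityTheory
open scoped NNReal

/-- `ℝ^d` with the Euclidean norm. -/
abbrev Vec (d : ℕ) : Type := EuclideanSpace ℝ (Fin d)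

/-- The uniform probability distribution on the unit sphere of `ℝ^d`, as a measure on `ℝ^d`:
the normalized surface measure, pushed forward along the inclusion. -/
noncomputable def uniformSphere (d : ℕ) : Measure (Vec d) :=
  (cond ((volume : Measure (Vec d)).toSphere) Set.univ).map Subtype.val

/-- The population objective `f(x) = E_ξ[f(x; ξ)]`. -/
noncomputable def objective {d : ℕ} {Ξ : Type*} [MeasurableSpace Ξ] (ν : Measure Ξ)
    (F : Vec d → Ξ → ℝ) (x : Vec d) : ℝ :=
  ∫ s, F x s ∂ν

/-- The randomized smoothing `f_μ(x) = E[f(x + μ u)]`, `u` uniform on the unit Euclidean ball. -/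
noncomputable def smoothing {d : ℕ} (μ : ℝ) (f : Vec d → ℝ) (x : Vec d) : ℝ :=
  ⨍ u in Metric.closedBall (0 : Vec d) 1, f (x + μ • u)

/-- The zeroth-order gradient estimate `(d/μ) [f(x + μ u) - f(x)] u`. -/
noncomputable def zoGrad {d : ℕ} (μ : ℝ) (f : Vec d → ℝ) (x u : Vec d) : Vec d :=
  ((d : ℝ) / μ * (f (x + μ • u) - f x)) • u

/-- The variables of ZO-AdaMM. After `t` iterations they are
`x = x_{t+1}`, `m = m_t`, `v = v_t` and `vhat = v̂_t`. -/
structure AdaMMState (d : ℕ) where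
  x : Vec d
  m : Vec d
  v : Fin d → ℝ
  vhat : Fin d → ℝ

namespace AdaMMState

/-- `m_t = β₁ m_{t-1} + (1 - β₁) g`. -/
noncomputable def nextM {d : ℕ} (β₁ : ℝ) (g : Vec d) (S : AdaMMState d) : Vec d :=
  β₁ • S.m + (1 - β₁) • g

/-- `v_t = β₂ v_{t-1} + (1 - β₂) g²`, coordinatewise. -/
noncomputable def nextV {d : ℕ} (β₂ : ℝ) (g : Vec d) (S : AdaMMState d) : Fin d → ℝ :=
  fun i => β₂ * S.v i + (1 - β₂) * g i ^ 2

/-- `v̂_t = max(v̂_{t-1}, v_t)`, coordinatewise. -/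
noncomputable def nextVhat {d : ℕ} (β₂ : ℝ) (g : Vec d) (S : AdaMMState d) : Fin d → ℝ :=
  fun i => max (S.vhat i) (S.nextV β₂ g i)

/-- `x_{t+1} = x_t - α V̂_t^{-1/2} m_t`, with `V̂_t = diag(v̂_t)`. -/
noncomputable def nextX {d : ℕ} (α β₁ β₂ : ℝ) (g : Vec d) (S : AdaMMState d) : Vec d :=
  WithLp.toLp 2 fun i => S.x i - α * (S.nextM β₁ g i / √(S.nextVhat β₂ g i))

/-- One unconstrained iteration, using the gradient estimate `g`. -/
noncomputable def next {d : ℕ} (α β₁ β₂ : ℝ) (g : Vec d) (S : AdaMMState d) : AdaMMState d where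
  x := S.nextX α β₁ β₂ g
  m := S.nextM β₁ g
  v := S.nextV β₂ g
  vhat := S.nextVhat β₂ g

end AdaMMState

/-- The input of unconstrained ZO-AdaMM: smoothing parameter, step sizes `α_t`, momentum parameters
`β_{1,t}` and `β₂`, initial point `x₁` and `v̂₀`. (Moreover `m₀ = 0` and `v₀ = 0`.) -/
structure AdaMMInput (d : ℕ) where
  μ : ℝ
  α : ℕ → ℝ
  β₁ : ℕ → ℝ
  β₂ : ℝ
  x₁ : Vec d
  vhat₀ : Fin d → ℝ

namespace AdaMMInput

variable {d : ℕ} {Ξ : Type*}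

/-- The state of unconstrained ZO-AdaMM after `t` iterations. Iteration `t ≥ 1` uses the sample
`ξ t` of the stochastic loss and the random direction `u t`. -/
noncomputable def state (I : AdaMMInput d) (F : Vec d → Ξ → ℝ) (ξ : ℕ → Ξ) (u : ℕ → Vec d) :
    ℕ → AdaMMState d
  | 0 => { x := I.x₁, m := 0, v := 0, vhat := I.vhat₀ }
  | t + 1 =>
      (I.state F ξ u t).next (I.α (t + 1)) (I.β₁ (t + 1)) I.β₂
        (zoGrad I.μ (fun y => F y (ξ (t + 1))) (I.state F ξ u t).x (u (t + 1)))

/-- The iterate `x_t`, for `t ≥ 1`. -/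
noncomputable def iterate (I : AdaMMInput d) (F : Vec d → Ξ → ℝ) (ξ : ℕ → Ξ) (u : ℕ → Vec d)
    (t : ℕ) : Vec d :=
  (I.state F ξ u (t - 1)).x

/-- The vector `v̂_t`. -/
noncomputable def vhat (I : AdaMMInput d) (F : Vec d → Ξ → ℝ) (ξ : ℕ → Ξ) (u : ℕ → Vec d)
    (t : ℕ) : Fin d → ℝ :=
  (I.state F ξ u t).vhat

/-- The gradient estimate `ĝ_t` at `x_t`, for `t ≥ 1`. -/
noncomputable def ghat (I : AdaMMInput d) (F : Vec d → Ξ → ℝ) (ξ : ℕ → Ξ) (u : ℕ → Vec d)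
    (t : ℕ) : Vec d :=
  zoGrad I.μ (fun y => F y (ξ t)) (I.iterate F ξ u t) (u t)

/-- The convergence measure `‖V̂_t^{-1/4} ∇f(x_t)‖²`, `V̂_t = diag(v̂_t)`, for the objective `f`. -/
noncomputable def gradMeasure (I : AdaMMInput d) (F : Vec d → Ξ → ℝ) (f : Vec d → ℝ)
    (ξ : ℕ → Ξ) (u : ℕ → Vec d) (t : ℕ) : ℝ :=
  ‖(WithLp.toLp 2 fun i =>
      I.vhat F ξ u t i ^ (-(1 / 4) : ℝ) * gradient f (I.iterate F ξ u t) i : Vec d)‖ ^ 2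

end AdaMMInput

/-- `max_{1 ≤ t ≤ T} ‖ĝ_t‖_∞ ≤ 2 L_c √(d log(dT/δ))`, for one realization of the noise;
the norm of `Fin d → ℝ` is the sup norm. -/
def EstimatesBounded {d : ℕ} {Ξ : Type*} (I : AdaMMInput d) (F : Vec d → Ξ → ℝ) (T : ℕ)
    (L_c δ : ℝ) (ξ : ℕ → Ξ) (u : ℕ → Vec d) : Prop :=
  ∀ t ∈ Finset.Icc 1 T,
    ‖WithLp.ofLp (I.ghat F ξ u t)‖ ≤ 2 * L_c * √(d * Real.log (d * T / δ))

/-! The rate is proved without conditioning, in the form Σ_{t≤T} E‖V̂_t^{-1/4}∇f(x_t)‖² ≤ K√(Td).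
Averaging over `R` turns this into K√(d/T). The averaged quantity is nonnegative and P(U) ≥ 1/3, so
conditioning on U costs at most a factor 3. The bound on P(U) is a union bound over the Td
coordinates of the estimates: |ĝ_{t,i}| ≤ d L_c |u_{t,i}|, and a coordinate of a uniform unit vector
is sub-Gaussian at scale 1/√d (`uniformSphere_lt_coord_le`).

For the sum, let D_t be the diagonal of V̂_t^{-1/2} and N_t = ∇f(x_{t+1}). The scaling D_{t+1}
depends on ĝ_{t+1}, but D is decreasing in t, so the measure at t+1 is at most ⟨D_t N_t, N_t⟩, whose
weight is known before ĝ_{t+1} is drawn. Since E[uuᵀ] = I/d, the expectation of this is that of ⟨D_t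
N_t, ĝ_{t+1}⟩ up to a bias O(dμ). The sum of these inner products is controlled along every path by
`sum_scaled_inner_le`: summation by parts replaces ĝ by the momentum m, the descent lemma bounds the
terms with m, and what remains is the drift of N and the change of D.

The change of D is the delicate error. The total decrease of D is of order d, and multiplying it by
the worst-case size of N·m would lose powers of d. Young's inequality with a weight λ separates it
into λB²d/2, with B = 1/c, and Σ‖q_t‖²/(2λ), where q is the coordinatewise product of N and ĝ.
Fourth moments on the sphere show that E ĝ_i² is bounded independently of d
(`integral_zoGrad_apply_sq_le`), so E‖ĝ‖² = O(d) while E‖q‖² = O(1). With λ = 1/(αd) and α²Td = 1,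
every error term is a multiple of 1/α = √(Td). -/

/-! ### Moments and tails of the uniform distribution on the sphere. -/

-- The surface measure of a set is d times the volume of the cone over it, so the factor d cancels
-- in the normalization. Invariance and tail bounds thereby reduce to volumes of subsets of the
-- ball.
open scoped Pointwise in
theorem uniformSphere_apply {d : ℕ} (hd : 1 ≤ d) {A : Set (Vec d)} (hA : MeasurableSet A) :
    uniformSphere d A = (volume (Metric.ball (0 : Vec d) 1))⁻¹ *
      volume {y : Vec d | y ≠ 0 ∧ ‖y‖ < 1 ∧ ‖y‖⁻¹ • y ∈ A} := by
  have hset : (Set.Ioo (0 : ℝ) 1 • (Subtype.val '' ((Subtype.val : Metric.sphere (0 : Vec d) 1 → Vec d) ⁻¹' A)))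
      = {y : Vec d | y ≠ 0 ∧ ‖y‖ < 1 ∧ ‖y‖⁻¹ • y ∈ A} := by
    ext y
    simp only [Set.mem_smul, Set.mem_image, Set.mem_preimage, Set.mem_ofPred_eq]
    constructor
    · rintro ⟨r, ⟨hr0, hr1⟩, _, ⟨⟨z, hz⟩, hzA, rfl⟩, rfl⟩
      have hz1 : ‖z‖ = 1 := by simpa using hz
      have hz0 : z ≠ 0 := by rintro rfl; simp at hz1
      refine ⟨smul_ne_zero hr0.ne' hz0, ?_, ?_⟩
      · simpa [norm_smul, hz1, abs_of_pos hr0] using hr1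
      · simpa [norm_smul, hz1, abs_of_pos hr0, smul_smul, hr0.ne'] using hzA
    · rintro ⟨hy0, hy1, hyA⟩
      have hn : 0 < ‖y‖ := norm_pos_iff.2 hy0
      refine ⟨‖y‖, ⟨hn, hy1⟩, ‖y‖⁻¹ • y, ⟨⟨‖y‖⁻¹ • y, ?_⟩, hyA, rfl⟩, ?_⟩
      · simp [norm_smul, hn.ne']
      · simp [smul_smul, hn.ne']
  have hdim : (Module.finrank ℝ (Vec d) : ENNReal) ≠ 0 := by
    simp; omega
  rw [uniformSphere, Measure.map_apply measurable_subtype_coe hA, cond_apply MeasurableSet.univ,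
    Set.univ_inter, Measure.toSphere_apply' _ (measurable_subtype_coe hA), hset,
    Measure.toSphere_apply_univ, ENNReal.mul_inv (Or.inl hdim) (Or.inl (by simp))]
  rw [mul_mul_mul_comm, ENNReal.inv_mul_cancel hdim (by simp), one_mul]

theorem isProbabilityMeasure_uniformSphere {d : ℕ} (hd : 1 ≤ d) :
    IsProbabilityMeasure (uniformSphere d) := by
  have : Nonempty (Fin d) := ⟨⟨0, hd⟩⟩
  have : NeZero ((volume : Measure (Vec d)).toSphere) := ⟨Measure.toSphere_ne_zero _⟩
  have : IsProbabilityMeasure (cond ((volume : Measure (Vec d)).toSphere) Set.univ) :=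
    cond_isProbabilityMeasure (by rw [Ne, Measure.measure_univ_eq_zero]; exact this.out)
  exact Measure.isProbabilityMeasure_map measurable_subtype_coe.aemeasurable

theorem ae_norm_eq_one_uniformSphere (d : ℕ) : ∀ᵐ u ∂uniformSphere d, ‖u‖ = 1 := by
  rw [uniformSphere, ae_map_iff measurable_subtype_coe.aemeasurable
    (measurableSet_eq_fun measurable_norm measurable_const)]
  exact Filter.Eventually.of_forall fun u => by simp

theorem map_uniformSphere_linearIsometryEquiv {d : ℕ} (hd : 1 ≤ d) (e : Vec d ≃ₗᵢ[ℝ] Vec d) :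
    (uniformSphere d).map e = uniformSphere d := by
  ext A hA
  have he : Measurable e := e.continuous.measurable
  rw [Measure.map_apply he hA, uniformSphere_apply hd hA, uniformSphere_apply hd (he hA)]
  congr 1
  have : {y : Vec d | y ≠ 0 ∧ ‖y‖ < 1 ∧ ‖y‖⁻¹ • y ∈ e ⁻¹' A}
      = e ⁻¹' {y : Vec d | y ≠ 0 ∧ ‖y‖ < 1 ∧ ‖y‖⁻¹ • y ∈ A} := by
    ext y; simp
  rw [this]
  exact e.measurePreserving.measure_preimage_equiv (f := e.toMeasurableEquiv) _

/-- The reflection in the hyperplane orthogonal to v - w exchanges v and w and preserves the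
measure. All moments below are reduced to coordinate moments this way. -/
theorem integral_uniformSphere_inner_eq {d : ℕ} (hd : 1 ≤ d) (φ : ℝ → ℝ) {v w : Vec d}
    (h : ‖v‖ = ‖w‖) :
    ∫ u, φ (inner ℝ v u) ∂uniformSphere d = ∫ u, φ (inner ℝ w u) ∂uniformSphere d := by
  set e := Submodule.reflection (ℝ ∙ (v - w))ᗮ with he
  have hev : e v = w := Submodule.reflection_sub h
  have key := integral_map_equiv (μ := uniformSphere d) e.toMeasurableEquiv
    (fun u => φ (inner ℝ w u))
  rw [LinearIsometryEquiv.coe_toMeasurableEquiv, map_uniformSphere_linearIsometryEquiv hd e] at key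
  rw [key, ← hev]
  simp

theorem Continuous.integrable_uniformSphere {d : ℕ} (hd : 1 ≤ d) {g : Vec d → ℝ}
    (hg : Continuous g) : Integrable g (uniformSphere d) := by
  have := isProbabilityMeasure_uniformSphere hd
  obtain ⟨C, hC⟩ := (isCompact_closedBall (0 : Vec d) 1).exists_bound_of_continuousOn
    hg.continuousOn
  refine Integrable.of_bound hg.aestronglyMeasurable C ?_
  filter_upwards [ae_norm_eq_one_uniformSphere d] with u hu
  exact hC u (by simp [hu])

/-- By invariance each coordinate has the same second moment, and the d of them sum to 1. -/
theorem integral_uniformSphere_inner_sq {d : ℕ} (hd : 1 ≤ d) (a : Vec d) :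
    ∫ u, inner ℝ a u ^ 2 ∂uniformSphere d = ‖a‖ ^ 2 / d := by
  have := isProbabilityMeasure_uniformSphere hd
  have hd0 : (d : ℝ) ≠ 0 := by positivity
  have h1 : ∀ i : Fin d, ∫ u, inner ℝ a u ^ 2 ∂uniformSphere d
      = ‖a‖ ^ 2 * ∫ u : Vec d, u i ^ 2 ∂uniformSphere d := by
    intro i
    rw [integral_uniformSphere_inner_eq hd (fun x => x ^ 2) (v := a)
      (w := ‖a‖ • EuclideanSpace.single i (1 : ℝ)) (by simp [norm_smul])]
    rw [← integral_const_mul]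
    refine integral_congr_ae (Filter.Eventually.of_forall fun u => ?_)
    simp [inner_smul_left, EuclideanSpace.inner_single_left, mul_pow]
  have h2 : ∑ i : Fin d, ∫ u : Vec d, u i ^ 2 ∂uniformSphere d = 1 := by
    rw [← integral_finsetSum _ fun i _ => Continuous.integrable_uniformSphere hd (by fun_prop)]
    rw [integral_congr_ae (g := fun _ => (1 : ℝ))]
    · simp
    · filter_upwards [ae_norm_eq_one_uniformSphere d] with u hu
      rw [← EuclideanSpace.real_norm_sq_eq, hu, one_pow]
  have h3 := Finset.sum_congr rfl fun i (_ : i ∈ Finset.univ) => h1 i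
  rw [← Finset.mul_sum, h2] at h3
  simp only [Finset.sum_const, Finset.card_univ, Fintype.card_fin, nsmul_eq_mul, mul_one] at h3
  rw [eq_div_iff hd0, mul_comm, h3]

theorem integral_uniformSphere_inner_mul_inner {d : ℕ} (hd : 1 ≤ d) (a b : Vec d) :
    ∫ u, inner ℝ a u * inner ℝ b u ∂uniformSphere d = inner ℝ a b / d := by
  have h : ∀ u : Vec d, inner ℝ a u * inner ℝ b u
      = (1 / 4) * (inner ℝ (a + b) u ^ 2 - inner ℝ (a - b) u ^ 2) := by
    intro u
    rw [inner_add_left, inner_sub_left]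
    ring
  simp_rw [h]
  rw [integral_const_mul, integral_sub (Continuous.integrable_uniformSphere hd (by fun_prop))
    (Continuous.integrable_uniformSphere hd (by fun_prop)), integral_uniformSphere_inner_sq hd,
    integral_uniformSphere_inner_sq hd, norm_add_sq_real, norm_sub_sq_real]
  ring

theorem integral_uniformSphere_coord_sq {d : ℕ} (hd : 1 ≤ d) (i : Fin d) :
    ∫ u : Vec d, u i ^ 2 ∂uniformSphere d = 1 / d := by
  have := integral_uniformSphere_inner_sq hd (EuclideanSpace.single i (1 : ℝ))
  simpa [EuclideanSpace.inner_single_left] using this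

/-- The fourth moment is the same along e_i, e_j and (e_i ± e_j)/√2. Adding the two rotated moments
cancels the odd terms of the expansion and leaves a linear relation for the mixed moment. -/
theorem integral_uniformSphere_coord_sq_mul_coord_sq {d : ℕ} (hd : 1 ≤ d) {i j : Fin d}
    (hij : i ≠ j) :
    3 * ∫ u : Vec d, u i ^ 2 * u j ^ 2 ∂uniformSphere d = ∫ u : Vec d, u i ^ 4 ∂uniformSphere d := by
  have hI : ∀ {g : Vec d → ℝ}, Continuous g → Integrable g (uniformSphere d) :=
    fun hg => Continuous.integrable_uniformSphere hd hg
  set s : ℝ := √2⁻¹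
  have hs2 : s ^ 2 = 2⁻¹ := Real.sq_sqrt (by norm_num)
  have hs4 : s ^ 4 = 4⁻¹ := by rw [show s ^ 4 = (s ^ 2) ^ 2 by ring, hs2]; norm_num
  let e : Fin d → Vec d := fun k => EuclideanSpace.single k (1 : ℝ)
  have hee : inner ℝ (e i) (e j) = 0 := by
    simp [e, EuclideanSpace.inner_single_left, hij]
  have hni : ‖e i‖ = 1 := by simp [e]
  have hnj : ‖e j‖ = 1 := by simp [e]
  have hp : ‖e i‖ = ‖s • (e i + e j)‖ := by
    rw [← sq_eq_sq₀ (norm_nonneg _) (norm_nonneg _), norm_smul, mul_pow, norm_add_sq_real, hee,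
      hni, hnj, Real.norm_eq_abs, sq_abs, hs2]
    norm_num
  have hm : ‖e i‖ = ‖s • (e i - e j)‖ := by
    rw [← sq_eq_sq₀ (norm_nonneg _) (norm_nonneg _), norm_smul, mul_pow, norm_sub_sq_real, hee,
      hni, hnj, Real.norm_eq_abs, sq_abs, hs2]
    norm_num
  have E1 := integral_uniformSphere_inner_eq hd (fun x => x ^ 4) hp
  have E2 := integral_uniformSphere_inner_eq hd (fun x => x ^ 4) hm
  have E3 := integral_uniformSphere_inner_eq hd (fun x => x ^ 4) (hni.trans hnj.symm)
  simp only [e, inner_smul_left, inner_add_left, inner_sub_left, EuclideanSpace.inner_single_left,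
    map_one, one_mul, mul_pow, RCLike.conj_to_real, hs4] at E1 E2 E3
  rw [integral_const_mul] at E1 E2
  have E4 : (∫ u : Vec d, (u i + u j) ^ 4 ∂uniformSphere d)
      + ∫ u : Vec d, (u i - u j) ^ 4 ∂uniformSphere d
      = 2 * (∫ u : Vec d, u i ^ 4 ∂uniformSphere d) + 2 * (∫ u : Vec d, u j ^ 4 ∂uniformSphere d)
        + 12 * ∫ u : Vec d, u i ^ 2 * u j ^ 2 ∂uniformSphere d := by
    rw [← integral_add (hI (by fun_prop)) (hI (by fun_prop)), ← integral_const_mul,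
      ← integral_const_mul, ← integral_const_mul,
      ← integral_add (hI (by fun_prop)) (hI (by fun_prop)),
      ← integral_add (hI (by fun_prop)) (hI (by fun_prop))]
    congr 1
    ext u
    ring
  linarith

/-- Write E u_i² = Σ_j E u_i²u_j², using ‖u‖ = 1. Each of the d summands is at least a third of the
fourth moment, and the left side is 1/d. -/
theorem integral_uniformSphere_coord_pow_four_le {d : ℕ} (hd : 1 ≤ d) (i : Fin d) :
    ∫ u : Vec d, u i ^ 4 ∂uniformSphere d ≤ 3 / d ^ 2 := by
  have hI : ∀ {g : Vec d → ℝ}, Continuous g → Integrable g (uniformSphere d) :=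
    fun hg => Continuous.integrable_uniformSphere hd hg
  have hd0 : (0 : ℝ) < d := by positivity
  set M := ∫ u : Vec d, u i ^ 4 ∂uniformSphere d with hM
  have hM0 : 0 ≤ M := integral_nonneg fun u => by positivity
  have h1 : (1 : ℝ) / d = ∑ j : Fin d, ∫ u : Vec d, u i ^ 2 * u j ^ 2 ∂uniformSphere d := by
    rw [← integral_uniformSphere_coord_sq hd i, ← integral_finsetSum _ fun j _ => hI (by fun_prop)]
    refine integral_congr_ae ?_
    filter_upwards [ae_norm_eq_one_uniformSphere d] with u hu
    rw [← Finset.mul_sum, ← EuclideanSpace.real_norm_sq_eq, hu]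
    simp
  have h2 : ∀ j : Fin d, M / 3 ≤ ∫ u : Vec d, u i ^ 2 * u j ^ 2 ∂uniformSphere d := by
    intro j
    by_cases hij : i = j
    · subst hij
      have : ∀ u : Vec d, u i ^ 2 * u i ^ 2 = u i ^ 4 := fun u => by ring
      simp_rw [this]
      linarith
    · linarith [integral_uniformSphere_coord_sq_mul_coord_sq hd hij]
  have h3 := Finset.sum_le_sum fun j (_ : j ∈ Finset.univ) => h2 j
  rw [← h1] at h3
  simp only [Finset.sum_const, Finset.card_univ, Fintype.card_fin, nsmul_eq_mul] at h3
  rw [le_div_iff₀ (by positivity)] at h3 ⊢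
  nlinarith

theorem integral_uniformSphere_inner_pow_four_le {d : ℕ} (hd : 1 ≤ d) (a : Vec d) :
    ∫ u, inner ℝ a u ^ 4 ∂uniformSphere d ≤ 3 * ‖a‖ ^ 4 / d ^ 2 := by
  let i : Fin d := ⟨0, hd⟩
  rw [integral_uniformSphere_inner_eq hd (fun x => x ^ 4) (v := a)
    (w := ‖a‖ • EuclideanSpace.single i (1 : ℝ)) (by simp [norm_smul])]
  have : ∀ u : Vec d, inner ℝ (‖a‖ • EuclideanSpace.single i (1 : ℝ)) u ^ 4
      = ‖a‖ ^ 4 * u i ^ 4 := by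
    intro u
    simp [inner_smul_left, EuclideanSpace.inner_single_left, mul_pow]
  simp_rw [this]
  rw [integral_const_mul]
  calc _ ≤ ‖a‖ ^ 4 * (3 / d ^ 2) := by
        gcongr
        exact integral_uniformSphere_coord_pow_four_le hd i
    _ = _ := by ring

theorem integral_uniformSphere_inner_sq_mul_coord_sq_le {d : ℕ} (hd : 1 ≤ d) {a : Vec d} {L : ℝ}
    (ha : ‖a‖ ≤ L) (i : Fin d) :
    ∫ u : Vec d, inner ℝ a u ^ 2 * u i ^ 2 ∂uniformSphere d ≤ 3 * L ^ 2 / d ^ 2 := by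
  have hI : ∀ {g : Vec d → ℝ}, Continuous g → Integrable g (uniformSphere d) :=
    fun hg => Continuous.integrable_uniformSphere hd hg
  have hL0 : 0 ≤ L := (norm_nonneg a).trans ha
  rcases hL0.eq_or_lt with h0 | hL
  · have : a = 0 := by simpa [← h0] using ha
    simp [this, ← h0]
  have hd0 : (0 : ℝ) < d := by positivity
  have h4 := integral_uniformSphere_inner_pow_four_le hd a
  have h5 := integral_uniformSphere_coord_pow_four_le hd i
  have h6 : ‖a‖ ^ 4 ≤ L ^ 4 := by gcongr
  calc ∫ u : Vec d, inner ℝ a u ^ 2 * u i ^ 2 ∂uniformSphere d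
      ≤ ∫ u : Vec d, (1 / (2 * L ^ 2)) * inner ℝ a u ^ 4 + (L ^ 2 / 2) * u i ^ 4
          ∂uniformSphere d := by
        refine integral_mono (hI (by fun_prop)) (hI (by fun_prop)) fun u => ?_
        dsimp only
        have : 0 ≤ (1 / (2 * L ^ 2)) * (inner ℝ a u ^ 2 - L ^ 2 * u i ^ 2) ^ 2 := by positivity
        have e : (1 / (2 * L ^ 2)) * (inner ℝ a u ^ 2 - L ^ 2 * u i ^ 2) ^ 2
          = (1 / (2 * L ^ 2)) * inner ℝ a u ^ 4 + (L ^ 2 / 2) * u i ^ 4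
            - inner ℝ a u ^ 2 * u i ^ 2 := by
          field_simp
          ring
        linarith
    _ = (1 / (2 * L ^ 2)) * (∫ u, inner ℝ a u ^ 4 ∂uniformSphere d)
        + (L ^ 2 / 2) * ∫ u : Vec d, u i ^ 4 ∂uniformSphere d := by
        rw [integral_add (hI (by fun_prop)) (hI (by fun_prop)), integral_const_mul,
          integral_const_mul]
    _ ≤ (1 / (2 * L ^ 2)) * (3 * L ^ 4 / d ^ 2) + (L ^ 2 / 2) * (3 / d ^ 2) := by
        gcongr
        exact h4.trans (by gcongr)
    _ = _ := by field_simp; ring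

/-- The cone over the cap fits into a ball of radius r with r² = 1 - 3s²/4, so the cap has
probability at most r^d, and 1 - x ≤ exp(-x) finishes. -/
theorem uniformSphere_lt_coord_le {d : ℕ} (hd : 1 ≤ d) (a : Vec d) (ha : ‖a‖ = 1) {s : ℝ}
    (hs : 0 ≤ s) :
    (uniformSphere d).real {u | s < inner ℝ a u} ≤ Real.exp (-(3 / 8) * (d * s ^ 2)) := by
  have := isProbabilityMeasure_uniformSphere hd
  have hmeas : MeasurableSet {u : Vec d | s < inner ℝ a u} :=
    measurableSet_lt measurable_const (by fun_prop)
  by_cases hs1 : 1 ≤ s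
  · have : (uniformSphere d) {u | s < inner ℝ a u} = 0 := by
      rw [measure_eq_zero_iff_ae_notMem]
      filter_upwards [ae_norm_eq_one_uniformSphere d] with u hu
      have := real_inner_le_norm a u
      rw [ha, hu] at this
      exact not_lt.2 (by linarith)
    rw [measureReal_def, this]
    simp [Real.exp_nonneg]
  push Not at hs1
  -- On the cone, ‖y - (s/2)a‖² ≤ ‖y‖² - s²‖y‖ + s²/4, which is convex in ‖y‖. Its value 1 - 3s²/4
  -- at ‖y‖ = 1 dominates the value s²/4 at 0 for every s ≤ 1, which is why the centre is (s/2)a.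
  set r : ℝ := √(1 - 3 / 4 * s ^ 2) with hr
  have hr0 : 0 ≤ r := Real.sqrt_nonneg _
  have hr2 : r ^ 2 = 1 - 3 / 4 * s ^ 2 := Real.sq_sqrt (by nlinarith)
  have hsub : {y : Vec d | y ≠ 0 ∧ ‖y‖ < 1 ∧ ‖y‖⁻¹ • y ∈ {u | s < inner ℝ a u}} ⊆
      Metric.closedBall ((s / 2) • a) r := by
    rintro y ⟨hy0, hy1, hy⟩
    have hn : 0 < ‖y‖ := norm_pos_iff.2 hy0
    simp only [Set.mem_ofPred_eq, inner_smul_right] at hy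
    rw [inv_mul_eq_div, lt_div_iff₀ hn] at hy
    rw [mem_closedBall_iff_norm, ← sq_le_sq₀ (norm_nonneg _) hr0, hr2, norm_sub_sq_real,
      inner_smul_right, norm_smul, ha, real_inner_comm, Real.norm_eq_abs, mul_one, sq_abs]
    nlinarith [mul_nonneg hn.le (sub_nonneg.2 hy1.le), mul_nonneg hs (sub_nonneg.2 hy.le), mul_nonneg (mul_nonneg hs hs) (sub_nonneg.2 hy1.le), mul_nonneg hs (sub_nonneg.2 hs1.le)]
  have hball : volume (Metric.closedBall ((s / 2) • a) r)
      = ENNReal.ofReal (r ^ d) * volume (Metric.ball (0 : Vec d) 1) := by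
    rw [Measure.addHaar_closedBall _ _ hr0]
    simp
  have hle : uniformSphere d {u | s < inner ℝ a u} ≤ ENNReal.ofReal (r ^ d) := by
    rw [uniformSphere_apply hd hmeas]
    calc _ ≤ (volume (Metric.ball (0 : Vec d) 1))⁻¹ * volume (Metric.closedBall ((s / 2) • a) r) := by
          gcongr
      _ = ENNReal.ofReal (r ^ d) := by
          rw [hball, mul_comm, mul_assoc, ENNReal.mul_inv_cancel (Metric.measure_ball_pos _ _ one_pos).ne'
            measure_ball_lt_top.ne, mul_one]
  have hre : r ≤ Real.exp (-(3 / 8) * s ^ 2) := by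
    rw [← sq_le_sq₀ hr0 (Real.exp_nonneg _), hr2, ← Real.exp_nat_mul]
    have := Real.add_one_le_exp (-(3 / 4) * s ^ 2)
    have e : ((2 : ℕ) : ℝ) * (-(3 / 8) * s ^ 2) = -(3 / 4) * s ^ 2 := by push_cast; ring
    rw [e]
    linarith
  calc _ ≤ r ^ d := ENNReal.toReal_le_of_le_ofReal (by positivity) hle
    _ ≤ Real.exp (-(3 / 8) * s ^ 2) ^ d := by gcongr
    _ = _ := by rw [← Real.exp_nat_mul]; congr 1; ring

theorem uniformSphere_lt_abs_coord_le {d : ℕ} (hd : 1 ≤ d) (i : Fin d) {s : ℝ} (hs : 0 ≤ s) :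
    (uniformSphere d).real {u | s < |u i|} ≤ 2 * Real.exp (-(3 / 8) * (d * s ^ 2)) := by
  have := isProbabilityMeasure_uniformSphere hd
  have h1 := uniformSphere_lt_coord_le hd (EuclideanSpace.single i (1 : ℝ)) (by simp) hs
  have h2 := uniformSphere_lt_coord_le hd (-EuclideanSpace.single i (1 : ℝ)) (by simp) hs
  have hsub : {u : Vec d | s < |u i|} ⊆ {u | s < inner ℝ (EuclideanSpace.single i (1 : ℝ)) u} ∪
      {u | s < inner ℝ (-EuclideanSpace.single i (1 : ℝ)) u} := by
    intro u hu
    simpa [EuclideanSpace.inner_single_left, inner_neg_left, lt_abs] using hu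
  calc _ ≤ _ := measureReal_mono hsub
    _ ≤ _ := measureReal_union_le _ _
    _ ≤ _ := by linarith

/-! ### Functions with Lipschitz gradient. -/

section Smooth

variable {E : Type*} [NormedAddCommGroup E] [InnerProductSpace ℝ E] [CompleteSpace E]

theorem hasDerivAt_comp_add_smul {f : E → ℝ} (hf : Differentiable ℝ f) (x v : E) (t : ℝ) :
    HasDerivAt (fun t : ℝ => f (x + t • v)) (inner ℝ (gradient f (x + t • v)) v) t := by
  have h1 : HasFDerivAt f _ (x + t • v) := (hf (x + t • v)).hasGradientAt.hasFDerivAt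
  have h2 : HasDerivAt (fun t : ℝ => x + t • v) v t := by
    simpa using ((hasDerivAt_id t).smul_const v).const_add x
  have h3 := h1.comp_hasDerivAt t h2
  rw [InnerProductSpace.toDual_apply_apply] at h3
  exact h3

/-- Along the segment, f minus the quadratic model has nonpositive derivative by Cauchy–Schwarz and
the Lipschitz bound. -/
theorem le_quadratic_of_lipschitz_gradient {f : E → ℝ} (hf : Differentiable ℝ f) {L : ℝ≥0}
    (hL : LipschitzWith L (gradient f)) (x v : E) :
    f (x + v) ≤ f x + inner ℝ (gradient f x) v + L / 2 * ‖v‖ ^ 2 := by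
  let φ : ℝ → ℝ := fun t => f (x + t • v) - t * inner ℝ (gradient f x) v - L / 2 * ‖v‖ ^ 2 * t ^ 2
  have hφ : ∀ t, HasDerivAt φ (inner ℝ (gradient f (x + t • v)) v - inner ℝ (gradient f x) v
      - L / 2 * ‖v‖ ^ 2 * (2 * t)) t := by
    intro t
    have h1 := hasDerivAt_comp_add_smul hf x v t
    have h2 : HasDerivAt (fun t : ℝ => t * inner ℝ (gradient f x) v) (inner ℝ (gradient f x) v) t := by
      simpa using (hasDerivAt_id t).mul_const (inner ℝ (gradient f x) v)
    have h3 : HasDerivAt (fun t : ℝ => L / 2 * ‖v‖ ^ 2 * t ^ 2) (L / 2 * ‖v‖ ^ 2 * (2 * t)) t := by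
      simpa using (hasDerivAt_pow 2 t).const_mul (L / 2 * ‖v‖ ^ 2)
    exact (h1.sub h2).sub h3
  have hanti : AntitoneOn φ (Set.Icc 0 1) := by
    refine antitoneOn_of_deriv_nonpos (convex_Icc 0 1)
      (fun t _ => (hφ t).continuousAt.continuousWithinAt)
      (fun t _ => (hφ t).differentiableAt.differentiableWithinAt) fun t ht => ?_
    rw [interior_Icc] at ht
    rw [(hφ t).deriv, ← inner_sub_left]
    have h1 := real_inner_le_norm (gradient f (x + t • v) - gradient f x) v
    have h2 := hL.norm_sub_le (x + t • v) x
    rw [add_sub_cancel_left, norm_smul, Real.norm_eq_abs, abs_of_pos ht.1] at h2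
    nlinarith [norm_nonneg v]
  have := hanti (Set.left_mem_Icc.2 zero_le_one) (Set.right_mem_Icc.2 zero_le_one) zero_le_one
  simp only [φ, one_smul, zero_smul, add_zero] at this
  linarith

theorem gradient_neg_fun {f : E → ℝ} (hf : Differentiable ℝ f) :
    gradient (fun x => -f x) = fun x => -gradient f x := by
  refine gradient_eq fun x => ?_
  rw [hasGradientAt_iff_hasFDerivAt, map_neg]
  exact (hf x).hasGradientAt.hasFDerivAt.neg

theorem abs_sub_sub_inner_gradient_le {f : E → ℝ} (hf : Differentiable ℝ f) {L : ℝ≥0}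
    (hL : LipschitzWith L (gradient f)) (x v : E) :
    |f (x + v) - f x - inner ℝ (gradient f x) v| ≤ L / 2 * ‖v‖ ^ 2 := by
  have h1 := le_quadratic_of_lipschitz_gradient hf hL x v
  have h2 := le_quadratic_of_lipschitz_gradient (f := fun x => -f x) hf.neg (L := L)
    (by rw [gradient_neg_fun hf]; exact hL.neg) x v
  rw [gradient_neg_fun hf, inner_neg_left] at h2
  exact abs_le.2 ⟨by linarith, by linarith⟩

theorem LipschitzWith.norm_gradient_le {f : E → ℝ} {L : ℝ≥0} (hf : LipschitzWith L f) (x : E) :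
    ‖gradient f x‖ ≤ L := by
  rw [gradient, LinearIsometryEquiv.norm_map]
  exact norm_fderiv_le_of_lipschitz ℝ hf

end Smooth

/-! ### Regularity of the expected loss. -/

section Objective

variable {d : ℕ} {Ξ : Type*} [MeasurableSpace Ξ] {ν : Measure Ξ} [IsProbabilityMeasure ν]
  {F : Vec d → Ξ → ℝ}

/-- Each partial derivative is a pointwise limit of difference quotients, which are measurable in
the sample. -/
theorem measurable_gradient_param (hmeas : ∀ x, Measurable (F x))
    (hdiff : ∀ s, Differentiable ℝ fun x => F x s) (x : Vec d) :
    Measurable fun s => gradient (fun y => F y s) x := by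
  have hcoord : ∀ i : Fin d, Measurable fun s => gradient (fun y => F y s) x i := by
    intro i
    let v : Vec d := EuclideanSpace.single i (1 : ℝ)
    have hgi : ∀ s, gradient (fun y => F y s) x i = inner ℝ (gradient (fun y => F y s) x) v := by
      intro s; rw [EuclideanSpace.inner_single_right]; simp
    refine measurable_of_tendsto_metrizable
      (f := fun (n : ℕ) s => ((n : ℝ) + 1) * (F (x + ((n : ℝ) + 1)⁻¹ • v) s - F x s))
      (fun n => ((hmeas _).sub (hmeas _)).const_mul _) ?_
    rw [tendsto_pi_nhds]
    intro s
    have h := hasDerivAt_comp_add_smul (hdiff s) x v 0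
    rw [hasDerivAt_iff_tendsto_slope_zero] at h
    have hn : Filter.Tendsto (fun n : ℕ => ((n : ℝ) + 1)⁻¹) Filter.atTop (nhdsWithin 0 {0}ᶜ) := by
      rw [tendsto_nhdsWithin_iff]
      refine ⟨?_, Filter.Eventually.of_forall fun n => ?_⟩
      · simpa using tendsto_one_div_add_atTop_nhds_zero_nat (𝕜 := ℝ)
      · simp only [Set.mem_compl_iff, Set.mem_singleton_iff]; positivity
    have := h.comp hn
    simpa [hgi, Function.comp_def] using this
  have : (fun s => gradient (fun y => F y s) x)
      = fun s => WithLp.toLp 2 fun i => gradient (fun y => F y s) x i := rfl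
  rw [this]
  exact (WithLp.measurable_toLp 2 _).comp (measurable_pi_lambda _ hcoord)

/-- Differentiation under the integral sign, with the uniform Lipschitz constant as dominating
function. -/
theorem hasGradientAt_objective (hint : ∀ x, Integrable (F x) ν) (hmeas : ∀ x, Measurable (F x))
    (hdiff : ∀ s, Differentiable ℝ fun x => F x s) {L : ℝ≥0}
    (hlip : ∀ s, LipschitzWith L fun x => F x s) (x : Vec d) :
    HasGradientAt (objective ν F) (∫ s, gradient (fun y => F y s) x ∂ν) x := by
  have hm := measurable_gradient_param hmeas hdiff x
  have hgi : Integrable (fun s => gradient (fun y => F y s) x) ν :=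
    Integrable.of_bound hm.aestronglyMeasurable L
      (Filter.Eventually.of_forall fun s => (hlip s).norm_gradient_le x)
  have h := (hasFDerivAt_integral_of_dominated_loc_of_lip (μ := ν) (𝕜 := ℝ)
    (F := F) (F' := fun s => InnerProductSpace.toDual ℝ (Vec d) (gradient (fun y => F y s) x))
    (x₀ := x) (bound := fun _ => (L : ℝ)) (s := Set.univ) Filter.univ_mem
    (Filter.Eventually.of_forall fun y => (hmeas y).aestronglyMeasurable) (hint x)
    ((InnerProductSpace.toDual ℝ (Vec d)).continuous.comp_aestronglyMeasurable
      hm.aestronglyMeasurable)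
    (Filter.Eventually.of_forall fun s => by
      simpa using (hlip s).lipschitzOnWith (s := Set.univ)) (integrable_const _)
    (Filter.Eventually.of_forall fun s => ((hdiff s) x).hasGradientAt.hasFDerivAt)).2
  rw [hasGradientAt_iff_hasFDerivAt]
  have e : InnerProductSpace.toDual ℝ (Vec d) (∫ s, gradient (fun y => F y s) x ∂ν)
      = ∫ s, InnerProductSpace.toDual ℝ (Vec d) (gradient (fun y => F y s) x) ∂ν :=
    ((InnerProductSpace.toDual ℝ (Vec d)).toContinuousLinearEquiv.toContinuousLinearMap.integral_comp_comm
      hgi).symm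
  rw [e]
  exact h

theorem differentiable_objective (hint : ∀ x, Integrable (F x) ν) (hmeas : ∀ x, Measurable (F x))
    (hdiff : ∀ s, Differentiable ℝ fun x => F x s) {L : ℝ≥0}
    (hlip : ∀ s, LipschitzWith L fun x => F x s) : Differentiable ℝ (objective ν F) :=
  fun x => (hasGradientAt_objective hint hmeas hdiff hlip x).differentiableAt

theorem lipschitzWith_objective (hint : ∀ x, Integrable (F x) ν) {L : ℝ≥0}
    (hlip : ∀ s, LipschitzWith L fun x => F x s) : LipschitzWith L (objective ν F) := by
  refine LipschitzWith.of_dist_le_mul fun x y => ?_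
  rw [Real.dist_eq, objective, objective, ← integral_sub (hint x) (hint y), ← Real.norm_eq_abs]
  refine (norm_integral_le_of_norm_le_const (C := L * dist x y)
    (Filter.Eventually.of_forall fun s => ?_)).trans (by simp)
  exact (hlip s).dist_le_mul x y

theorem lipschitzWith_gradient_objective (hint : ∀ x, Integrable (F x) ν)
    (hmeas : ∀ x, Measurable (F x)) (hdiff : ∀ s, Differentiable ℝ fun x => F x s) {Lg L : ℝ≥0}
    (hgrad : ∀ s, LipschitzWith Lg (gradient fun x => F x s))
    (hlip : ∀ s, LipschitzWith L fun x => F x s) :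
    LipschitzWith Lg (gradient (objective ν F)) := by
  have hgi : ∀ x, Integrable (fun s => gradient (fun y => F y s) x) ν := fun x =>
    Integrable.of_bound (measurable_gradient_param hmeas hdiff x).aestronglyMeasurable L
      (Filter.Eventually.of_forall fun s => (hlip s).norm_gradient_le x)
  refine LipschitzWith.of_dist_le_mul fun x y => ?_
  rw [(hasGradientAt_objective hint hmeas hdiff hlip x).gradient,
    (hasGradientAt_objective hint hmeas hdiff hlip y).gradient, dist_eq_norm,
    ← integral_sub (hgi x) (hgi y)]
  refine (norm_integral_le_of_norm_le_const (C := Lg * dist x y)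
    (Filter.Eventually.of_forall fun s => ?_)).trans (by simp)
  rw [← dist_eq_norm]
  exact (hgrad s).dist_le_mul x y

end Objective

/-- Transfers the bound on the gap of the smoothed function to the objective itself, so that the
rest of the argument never needs the smoothing. -/
theorem abs_smoothing_sub_le {d : ℕ} {f : Vec d → ℝ} {L : ℝ≥0} (hf : LipschitzWith L f) {μ : ℝ}
    (hμ : 0 ≤ μ) (x : Vec d) : |smoothing μ f x - f x| ≤ L * μ := by
  have hK : volume (Metric.closedBall (0 : Vec d) 1) ≠ 0 :=
    (Metric.measure_closedBall_pos _ _ one_pos).ne'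
  have hK' : volume (Metric.closedBall (0 : Vec d) 1) ≠ ⊤ := measure_closedBall_lt_top.ne
  have hi : IntegrableOn (fun u => f (x + μ • u)) (Metric.closedBall (0 : Vec d) 1) :=
    (hf.continuous.comp (by fun_prop)).continuousOn.integrableOn_compact
      (isCompact_closedBall _ _)
  have hprob : IsProbabilityMeasure (cond (volume : Measure (Vec d)) (Metric.closedBall 0 1)) :=
    cond_isProbabilityMeasure_of_finite hK hK'
  have h1 : smoothing μ f x = ∫ u, f (x + μ • u) ∂(cond (volume : Measure (Vec d)) (Metric.closedBall 0 1)) := by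
    rw [smoothing, setAverage_eq, ProbabilityTheory.cond, integral_smul_measure, measureReal_def,
      ENNReal.toReal_inv]
  have hi' : Integrable (fun u => f (x + μ • u)) (cond (volume : Measure (Vec d)) (Metric.closedBall 0 1)) :=
    hi.integrable.smul_measure (by simpa using hK)
  have h2 : f x = ∫ u, f x ∂(cond (volume : Measure (Vec d)) (Metric.closedBall 0 1)) := by simp
  rw [h1, h2, ← integral_sub hi' (integrable_const _), ← Real.norm_eq_abs]
  refine (norm_integral_le_of_norm_le_const (C := L * μ) ?_).trans (by simp)
  filter_upwards [ae_cond_mem Metric.isClosed_closedBall.measurableSet] with u hu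
  refine (hf.dist_le_mul _ _).trans ?_
  rw [dist_eq_norm, add_sub_cancel_left, norm_smul, Real.norm_eq_abs, abs_of_nonneg hμ]
  have : ‖u‖ ≤ 1 := by simpa using hu
  gcongr
  nlinarith

/-! ### Momentum averages and the pathwise estimate. -/

theorem sum_le_of_contraction {a b : ℕ → ℝ} {β : ℝ} (hβ : 0 ≤ β) (ha : ∀ t, 0 ≤ a t)
    (ha0 : a 0 = 0) (h : ∀ t, a (t + 1) ≤ β * a t + b t) (T : ℕ) :
    (1 - β) * ∑ t ∈ Finset.range T, a (t + 1) ≤ ∑ t ∈ Finset.range T, b t := by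
  have key : (1 - β) * ∑ t ∈ Finset.range T, a (t + 1) + β * a T ≤ ∑ t ∈ Finset.range T, b t := by
    induction T with
    | zero => simp [ha0]
    | succ n ih =>
      rw [Finset.sum_range_succ, Finset.sum_range_succ]
      linarith [h n]
  linarith [mul_nonneg hβ (ha T)]

/-- Convexity of the squared norm gives ‖y_{t+1}‖² ≤ β‖y_t‖² + (1-β)‖q_{t+1}‖²; summing cancels the
factor 1-β. Used for m built from g and for the auxiliary average of q. -/
theorem sum_norm_sq_momentum_le {E : Type*} [NormedAddCommGroup E] [InnerProductSpace ℝ E]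
    {y q : ℕ → E} {β : ℝ} (hβ : 0 ≤ β) (hβ1 : β < 1) (hy0 : y 0 = 0)
    (hy : ∀ t, y (t + 1) = β • y t + (1 - β) • q (t + 1)) (T : ℕ) :
    ∑ t ∈ Finset.range T, ‖y (t + 1)‖ ^ 2 ≤ ∑ t ∈ Finset.range T, ‖q (t + 1)‖ ^ 2 := by
  have h := sum_le_of_contraction (a := fun t => ‖y t‖ ^ 2)
    (b := fun t => (1 - β) * ‖q (t + 1)‖ ^ 2) hβ (fun t => by positivity) (by simp [hy0])
    (fun t => by
      have h1 : ‖y (t + 1)‖ ≤ β * ‖y t‖ + (1 - β) * ‖q (t + 1)‖ := by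
        rw [hy]
        refine (norm_add_le _ _).trans ?_
        rw [norm_smul, norm_smul, Real.norm_of_nonneg hβ, Real.norm_of_nonneg (by linarith)]
      have h2 : ‖y (t + 1)‖ ^ 2 ≤ (β * ‖y t‖ + (1 - β) * ‖q (t + 1)‖) ^ 2 := by gcongr
      nlinarith [mul_nonneg (mul_nonneg hβ (sub_nonneg.2 hβ1.le)) (sq_nonneg (‖y t‖ - ‖q (t + 1)‖))]) T
  rw [← Finset.mul_sum] at h
  exact le_of_mul_le_mul_left h (by linarith)

theorem sum_abs_mul_le_norm_mul_norm {d : ℕ} (a b : Vec d) :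
    ∑ i, |a i * b i| ≤ ‖a‖ * ‖b‖ := by
  simp_rw [abs_mul]
  rw [EuclideanSpace.norm_eq, EuclideanSpace.norm_eq]
  simpa using Real.sum_mul_le_sqrt_mul_sqrt Finset.univ (fun i => |a i|) (fun i => |b i|)

set_option maxHeartbeats 1000000 in
/-- The pathwise estimate behind the convergence of adaptive momentum methods: `m` is the momentum
built from the gradient estimates `g`, `D` the coordinatewise scaling, `N` the gradients and `φ` the
objective values along the iterates. -/
theorem sum_scaled_inner_le {d : ℕ} {N m g q : ℕ → Vec d} {D : ℕ → Fin d → ℝ} {φ : ℕ → ℝ}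
    {α β B L G lam : ℝ} (hα : 0 < α) (hβ : 0 ≤ β) (hβ1 : β < 1) (hB : 0 ≤ B) (hL : 0 ≤ L)
    (hG : 0 ≤ G) (hlam : 0 < lam)
    (hD0 : ∀ t i, 0 ≤ D t i) (hDB : ∀ t i, D t i ≤ B) (hD : ∀ t i, D (t + 1) i ≤ D t i)
    (hm0 : m 0 = 0) (hm : ∀ t, m (t + 1) = β • m t + (1 - β) • g (t + 1))
    (hNG : ∀ t, ‖N t‖ ≤ G) (hN : ∀ t, ‖N (t + 1) - N t‖ ≤ L * (α * B * ‖m (t + 1)‖))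
    (hq : ∀ t i, q (t + 1) i = N t i * g (t + 1) i)
    (hφ : ∀ t, φ (t + 1) ≤ φ t - α * ∑ i, D (t + 1) i * (N t i * m (t + 1) i)
      + L / 2 * (α * B * ‖m (t + 1)‖) ^ 2) (T : ℕ) :
    (1 - β) ^ 2 * ∑ t ∈ Finset.range T, ∑ i, D t i * (N t i * g (t + 1) i) ≤
      (φ 0 - φ T) * (1 - β) ^ 2 / α + B * G / 2 / α + lam * B ^ 2 * d / 2
      + (5 / 2 * L * B ^ 2 + B * G / 2) * α * ∑ t ∈ Finset.range T, ‖g (t + 1)‖ ^ 2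
      + 1 / (2 * lam) * ∑ t ∈ Finset.range T, ‖q (t + 1)‖ ^ 2 := by
  have h1β : 0 < 1 - β := by linarith
  set Sm := ∑ t ∈ Finset.range T, ‖m (t + 1)‖ ^ 2 with hSm
  set Sg := ∑ t ∈ Finset.range T, ‖g (t + 1)‖ ^ 2 with hSg
  set Sq := ∑ t ∈ Finset.range T, ‖q (t + 1)‖ ^ 2 with hSq
  have hSm0 : 0 ≤ Sm := Finset.sum_nonneg fun _ _ => by positivity
  have hSmg : Sm ≤ Sg := sum_norm_sq_momentum_le hβ hβ1 hm0 hm T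
  -- W = N_{t-1}·m_t obeys the momentum recursion driven by q, perturbed by the drift e of N. Split
  -- W = Y + R: Y is the unperturbed momentum of q, with square sum controlled by that of q, and R
  -- collects the drift and is small in ℓ¹. At t = 0 the truncated index in `N (t - 1)` is harmless
  -- because m_0 = 0.
  let Y : ℕ → Vec d := fun t => Nat.rec 0 (fun t y => β • y + (1 - β) • q (t + 1)) t
  have hY0 : Y 0 = 0 := rfl
  have hY : ∀ t, Y (t + 1) = β • Y t + (1 - β) • q (t + 1) := fun t => rfl
  have hSY : ∑ t ∈ Finset.range T, ‖Y (t + 1)‖ ^ 2 ≤ Sq :=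
    sum_norm_sq_momentum_le hβ hβ1 hY0 hY T
  let W : ℕ → Fin d → ℝ := fun t i => N (t - 1) i * m t i
  let e : ℕ → Fin d → ℝ := fun t i => (N t i - N (t - 1) i) * m t i
  let R : ℕ → Fin d → ℝ := fun t i => W t i - Y t i
  let h : ℕ → ℝ := fun t => ∑ i, D t i * W t i
  let p : ℕ → ℝ := fun t => ∑ i, D t i * (N t i * g (t + 1) i)
  let e1 : ℕ → ℝ := fun t => ∑ i, |e t i|
  let R1 : ℕ → ℝ := fun t => ∑ i, |R t i|
  have hW : ∀ t i, W (t + 1) i = β * (W t i + e t i) + (1 - β) * (N t i * g (t + 1) i) := by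
    intro t i
    simp only [W, e, hm, Nat.add_sub_cancel, PiLp.add_apply, PiLp.smul_apply, smul_eq_mul]
    ring
  have hR : ∀ t i, R (t + 1) i = β * (R t i + e t i) := by
    intro t i
    simp only [R, hW, hY, PiLp.add_apply, PiLp.smul_apply, smul_eq_mul, hq]
    ring
  have he10 : ∀ t, 0 ≤ e1 t := fun t => Finset.sum_nonneg fun _ _ => abs_nonneg _
  have hR10 : ∀ t, 0 ≤ R1 t := fun t => Finset.sum_nonneg fun _ _ => abs_nonneg _
  have hR1 : ∀ t, R1 (t + 1) ≤ β * R1 t + β * e1 t := by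
    intro t
    simp only [R1, e1]
    rw [← mul_add, ← Finset.sum_add_distrib, Finset.mul_sum]
    refine Finset.sum_le_sum fun i _ => ?_
    rw [hR, abs_mul, abs_of_nonneg hβ]
    gcongr
    exact abs_add_le _ _
  have hSR : (1 - β) * ∑ t ∈ Finset.range T, R1 (t + 1) ≤ β * ∑ t ∈ Finset.range T, e1 t := by
    rw [Finset.mul_sum (a := β)]
    exact sum_le_of_contraction hβ hR10 (by simp [R1, R, W, hm0, hY0]) hR1 T
  have he1 : ∀ t, e1 (t + 1) ≤ L * (α * B) * ‖m (t + 1)‖ ^ 2 := by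
    intro t
    calc e1 (t + 1) ≤ ‖N (t + 1) - N t‖ * ‖m (t + 1)‖ := by
          simpa [e1, e] using sum_abs_mul_le_norm_mul_norm (N (t + 1) - N t) (m (t + 1))
      _ ≤ L * (α * B * ‖m (t + 1)‖) * ‖m (t + 1)‖ := by gcongr; exact hN t
      _ = _ := by ring
  have hSe : ∑ t ∈ Finset.range T, e1 t ≤ L * (α * B) * Sm := by
    have h0 : e1 0 = 0 := by simp [e1, e, hm0]
    have h1 : ∑ t ∈ Finset.range T, e1 t ≤ ∑ t ∈ Finset.range (T + 1), e1 t := by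
      rw [Finset.sum_range_succ]
      linarith [he10 T]
    rw [Finset.sum_range_succ', h0, add_zero] at h1
    refine h1.trans ?_
    rw [hSm, Finset.mul_sum]
    exact Finset.sum_le_sum fun t _ => he1 t
  -- Summation by parts: solve the recursion of W for N·g, then trade the weight D_t on W_{t+1} for
  -- D_{t+1}. The difference (D_t - D_{t+1})·W_{t+1} is estimated separately on Y and on R.
  have hstep : ∀ t, (1 - β) * p t ≤ (h (t + 1) - β * h t) + β * B * e1 t
      + lam * B / 2 * (∑ i, D t i - ∑ i, D (t + 1) i) + 1 / (2 * lam) * ‖Y (t + 1)‖ ^ 2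
      + B * R1 (t + 1) := by
    intro t
    rw [EuclideanSpace.real_norm_sq_eq]
    simp only [p, h, e1, R1]
    simp only [← Finset.sum_sub_distrib, Finset.mul_sum, ← Finset.sum_add_distrib]
    refine Finset.sum_le_sum fun i _ => ?_
    have hWR : W (t + 1) i = Y (t + 1) i + R (t + 1) i := by simp [R]
    have hb0 : 0 ≤ D t i - D (t + 1) i := sub_nonneg.2 (hD t i)
    have hbB : D t i - D (t + 1) i ≤ B := by linarith [hDB t i, hD0 (t + 1) i]
    have e2 : -(D t i * e t i) ≤ B * |e t i| := by
      calc -(D t i * e t i) ≤ |D t i * e t i| := neg_le_abs _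
        _ = D t i * |e t i| := by rw [abs_mul, abs_of_nonneg (hD0 t i)]
        _ ≤ _ := by gcongr; exact hDB t i
    have e3 : (D t i - D (t + 1) i) * R (t + 1) i ≤ B * |R (t + 1) i| := by
      calc _ ≤ (D t i - D (t + 1) i) * |R (t + 1) i| := by gcongr; exact le_abs_self _
        _ ≤ _ := by gcongr
    -- Young's inequality with weight λ. Since 0 ≤ D_t - D_{t+1} ≤ B, the square of the decrement is
    -- at most B times the decrement, and so telescopes.
    have e4 : (D t i - D (t + 1) i) * Y (t + 1) i ≤
        lam * B / 2 * (D t i - D (t + 1) i) + 1 / (2 * lam) * Y (t + 1) i ^ 2 := by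
      have h1 : 0 ≤ 1 / (2 * lam) * (lam * (D t i - D (t + 1) i) - Y (t + 1) i) ^ 2 := by
        positivity
      have h2 : 1 / (2 * lam) * (lam * (D t i - D (t + 1) i) - Y (t + 1) i) ^ 2
          = lam / 2 * (D t i - D (t + 1) i) ^ 2 - (D t i - D (t + 1) i) * Y (t + 1) i
            + 1 / (2 * lam) * Y (t + 1) i ^ 2 := by
        field_simp
        ring
      have h3 : lam / 2 * (D t i - D (t + 1) i) ^ 2 ≤ lam * B / 2 * (D t i - D (t + 1) i) := by
        nlinarith [mul_nonneg hlam.le (mul_nonneg hb0 (sub_nonneg.2 hbB))]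
      linarith
    have e5 : (1 - β) * (D t i * (N t i * g (t + 1) i)) = D (t + 1) i * W (t + 1) i
        - β * (D t i * W t i) - β * (D t i * e t i) + (D t i - D (t + 1) i) * W (t + 1) i := by
      rw [hW]; ring
    have e6 : β * (-(D t i * e t i)) ≤ β * (B * |e t i|) := by gcongr
    rw [e5]
    nth_rewrite 2 [hWR]
    linarith
  have hsum := Finset.sum_le_sum fun t (_ : t ∈ Finset.range T) => hstep t
  simp only [Finset.sum_add_distrib, ← Finset.mul_sum] at hsum
  rw [Finset.sum_range_sub' (fun t => ∑ i, D t i)] at hsum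
  have hDsum : ∑ i, D 0 i - ∑ i, D T i ≤ B * d := by
    have h1 : ∑ i, D 0 i ≤ ∑ _i : Fin d, B := Finset.sum_le_sum fun i _ => hDB 0 i
    have h2 : 0 ≤ ∑ i, D T i := Finset.sum_nonneg fun i _ => hD0 T i
    simp only [Finset.sum_const, Finset.card_univ, Fintype.card_fin, nsmul_eq_mul] at h1
    linarith
  have hh0 : h 0 = 0 := by simp [h, W, hm0]
  have htel : ∑ t ∈ Finset.range T, (h (t + 1) - β * h t)
      = (1 - β) * ∑ t ∈ Finset.range T, h (t + 1) + β * h T := by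
    clear * - hh0
    induction T with
    | zero => simp [hh0]
    | succ n ih => rw [Finset.sum_range_succ, Finset.sum_range_succ, ih]; ring
  -- The term h_{t+1} is exactly the first-order decrease in the descent inequality.
  have hdesc : α * ∑ t ∈ Finset.range T, h (t + 1) ≤ φ 0 - φ T + L / 2 * (α * B) ^ 2 * Sm := by
    rw [← Finset.sum_range_sub' φ, hSm, Finset.mul_sum, Finset.mul_sum, ← Finset.sum_add_distrib]
    refine Finset.sum_le_sum fun t _ => ?_
    have h1 := hφ t
    have h2 : h (t + 1) = ∑ i, D (t + 1) i * (N t i * m (t + 1) i) := by simp [h, W]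
    rw [h2]
    nlinarith
  have hmT : ‖m T‖ ^ 2 ≤ Sm := by
    cases T with
    | zero => simp [hm0, hSm]
    | succ n =>
      rw [hSm, Finset.sum_range_succ]
      have : 0 ≤ ∑ t ∈ Finset.range n, ‖m (t + 1)‖ ^ 2 := Finset.sum_nonneg fun _ _ => by positivity
      linarith
  -- Boundary term of the summation by parts. The AM–GM split 2‖m_T‖ ≤ α‖m_T‖² + 1/α puts it at the
  -- scale of the other errors.
  have hhT : h T ≤ B * G / 2 * (α * Sm + 1 / α) := by
    have h1 : h T ≤ B * (G * ‖m T‖) := by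
      calc h T ≤ ∑ i, B * |N (T - 1) i * m T i| := by
            refine Finset.sum_le_sum fun i _ => ?_
            calc D T i * W T i ≤ D T i * |W T i| := by
                  gcongr
                  · exact hD0 T i
                  · exact le_abs_self _
              _ ≤ B * |W T i| := by gcongr; exact hDB T i
        _ ≤ B * (‖N (T - 1)‖ * ‖m T‖) := by
            rw [← Finset.mul_sum]
            gcongr
            exact sum_abs_mul_le_norm_mul_norm _ _
        _ ≤ _ := by gcongr; exact hNG _
    have h2 : 2 * ‖m T‖ ≤ α * ‖m T‖ ^ 2 + 1 / α := by
      have : 0 ≤ 1 / α * (α * ‖m T‖ - 1) ^ 2 := by positivity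
      have e' : 1 / α * (α * ‖m T‖ - 1) ^ 2 = α * ‖m T‖ ^ 2 + 1 / α - 2 * ‖m T‖ := by
        field_simp
        ring
      linarith
    have h3 : α * ‖m T‖ ^ 2 ≤ α * Sm := by gcongr
    calc h T ≤ _ := h1
      _ = B * G / 2 * (2 * ‖m T‖) := by ring
      _ ≤ _ := by gcongr; linarith
  have hSp : (1 - β) * ∑ t ∈ Finset.range T, p t ≤ ((1 - β) * ∑ t ∈ Finset.range T, h (t + 1)
      + β * h T) + β * B * ∑ t ∈ Finset.range T, e1 t + lam * B / 2 * (B * d)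
      + 1 / (2 * lam) * Sq + B * ∑ t ∈ Finset.range T, R1 (t + 1) := by
    rw [← htel]
    have h1 : lam * B / 2 * (∑ i, D 0 i - ∑ i, D T i) ≤ lam * B / 2 * (B * d) := by gcongr
    have h2 : 1 / (2 * lam) * ∑ t ∈ Finset.range T, ‖Y (t + 1)‖ ^ 2 ≤ 1 / (2 * lam) * Sq := by
      gcongr
    linarith
  have hd2 : ∑ t ∈ Finset.range T, h (t + 1) ≤ (φ 0 - φ T) / α + L / 2 * α * B ^ 2 * Sm := by
    have : (φ 0 - φ T) / α + L / 2 * α * B ^ 2 * Sm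
        = (φ 0 - φ T + L / 2 * (α * B) ^ 2 * Sm) / α := by field_simp
    rw [this, le_div_iff₀ hα]
    linarith
  have hq1 : (1 - β) ^ 2 * ∑ t ∈ Finset.range T, h (t + 1) ≤
      (1 - β) ^ 2 * ((φ 0 - φ T) / α) + L / 2 * α * B ^ 2 * Sg := by
    have hb : (1 - β) ^ 2 ≤ 1 := by nlinarith
    have hx : 0 ≤ L / 2 * α * B ^ 2 * Sm := by positivity
    have hx' : L / 2 * α * B ^ 2 * Sm ≤ L / 2 * α * B ^ 2 * Sg := by gcongr
    nlinarith [mul_le_mul_of_nonneg_left hd2 (sq_nonneg (1 - β))]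
  have hc1 : (1 - β) * β ≤ 1 := by nlinarith
  have hq2 : (1 - β) * β * h T ≤ B * G / 2 * (α * Sg + 1 / α) := by
    calc (1 - β) * β * h T ≤ (1 - β) * β * (B * G / 2 * (α * Sm + 1 / α)) := by gcongr
      _ ≤ 1 * (B * G / 2 * (α * Sm + 1 / α)) := by gcongr
      _ ≤ _ := by rw [one_mul]; gcongr
  have hSe' : ∑ t ∈ Finset.range T, e1 t ≤ L * (α * B) * Sg := hSe.trans (by gcongr)
  have hSe0 : 0 ≤ ∑ t ∈ Finset.range T, e1 t := Finset.sum_nonneg fun t _ => he10 t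
  have hq3 : (1 - β) * (β * B * ∑ t ∈ Finset.range T, e1 t) ≤ B * (L * (α * B) * Sg) := by
    calc _ = (1 - β) * β * (B * ∑ t ∈ Finset.range T, e1 t) := by ring
      _ ≤ 1 * (B * ∑ t ∈ Finset.range T, e1 t) := by gcongr
      _ ≤ _ := by rw [one_mul]; gcongr
  have hq4 : (1 - β) * (B * ∑ t ∈ Finset.range T, R1 (t + 1)) ≤ B * (L * (α * B) * Sg) := by
    calc _ = B * ((1 - β) * ∑ t ∈ Finset.range T, R1 (t + 1)) := by ring
      _ ≤ B * (1 * ∑ t ∈ Finset.range T, e1 t) :=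
          mul_le_mul_of_nonneg_left (hSR.trans (mul_le_mul_of_nonneg_right hβ1.le hSe0)) hB
      _ ≤ _ := by rw [one_mul]; gcongr
  have hSq0 : 0 ≤ Sq := Finset.sum_nonneg fun _ _ => by positivity
  have hq5 : (1 - β) * (lam * B / 2 * (B * d) + 1 / (2 * lam) * Sq) ≤
      lam * B / 2 * (B * d) + 1 / (2 * lam) * Sq :=
    mul_le_of_le_one_left (by positivity) (by linarith)
  -- The second factor 1-β is the one that `hSR` needs to bound the sum of R. In the total, 5/2 =
  -- 1/2 + 1 + 1 comes from the descent inequality, the drift e, and R.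
  have hfin := mul_le_mul_of_nonneg_left hSp h1β.le
  calc _ = (1 - β) * ((1 - β) * ∑ t ∈ Finset.range T, p t) := by ring
    _ ≤ _ := hfin
    _ = (1 - β) ^ 2 * ∑ t ∈ Finset.range T, h (t + 1) + (1 - β) * β * h T
        + (1 - β) * (β * B * ∑ t ∈ Finset.range T, e1 t)
        + (1 - β) * (B * ∑ t ∈ Finset.range T, R1 (t + 1))
        + (1 - β) * (lam * B / 2 * (B * d) + 1 / (2 * lam) * Sq) := by ring
    _ ≤ ((1 - β) ^ 2 * ((φ 0 - φ T) / α) + L / 2 * α * B ^ 2 * Sg)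
        + B * G / 2 * (α * Sg + 1 / α) + B * (L * (α * B) * Sg) + B * (L * (α * B) * Sg)
        + (lam * B / 2 * (B * d) + 1 / (2 * lam) * Sq) := by linarith
    _ = _ := by ring

/-! ### Size, second moment and bias of the gradient estimate for a fixed function. -/

theorem zoGrad_apply {d : ℕ} (μ : ℝ) (f : Vec d → ℝ) (x u : Vec d) (i : Fin d) :
    zoGrad μ f x u i = (d : ℝ) / μ * (f (x + μ • u) - f x) * u i := by
  simp [zoGrad]

theorem norm_zoGrad_le {d : ℕ} {μ : ℝ} (hμ : 0 < μ) {f : Vec d → ℝ} {L : ℝ≥0}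
    (hf : LipschitzWith L f) (x : Vec d) {u : Vec d} (hu : ‖u‖ = 1) :
    ‖zoGrad μ f x u‖ ≤ d * L := by
  have h := hf.norm_sub_le (x + μ • u) x
  rw [add_sub_cancel_left, norm_smul, hu, mul_one, Real.norm_of_nonneg hμ.le] at h
  rw [zoGrad, norm_smul, hu, mul_one, norm_mul, Real.norm_of_nonneg (by positivity)]
  calc _ ≤ (d : ℝ) / μ * (L * μ) := by gcongr
    _ = _ := by field_simp

theorem abs_zoGrad_apply_le {d : ℕ} {μ : ℝ} (hμ : 0 < μ) {f : Vec d → ℝ} {L : ℝ≥0}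
    (hf : LipschitzWith L f) (x : Vec d) {u : Vec d} (hu : ‖u‖ = 1) (i : Fin d) :
    |zoGrad μ f x u i| ≤ d * L * |u i| := by
  have h := hf.norm_sub_le (x + μ • u) x
  rw [add_sub_cancel_left, norm_smul, hu, mul_one, Real.norm_of_nonneg hμ.le,
    Real.norm_eq_abs] at h
  rw [zoGrad_apply, abs_mul, abs_mul, abs_of_nonneg (a := (d : ℝ) / μ) (by positivity)]
  calc _ ≤ (d : ℝ) / μ * (L * μ) * |u i| := by gcongr
    _ = _ := by field_simp

theorem continuous_zoGrad_apply {d : ℕ} (μ : ℝ) {f : Vec d → ℝ} (hf : Continuous f) (x : Vec d)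
    (i : Fin d) : Continuous fun u => zoGrad μ f x u i := by
  simp_rw [zoGrad_apply]
  fun_prop

/-- The linear part of the estimate is d⟨∇f, u⟩u_i, whose second moment is at most 3L² by the fourth
moments on the sphere; the Taylor remainder gives the rest. The main term is free of d, although the
norm of the estimate can be as large as dL. -/
theorem integral_zoGrad_apply_sq_le {d : ℕ} (hd : 1 ≤ d) {μ : ℝ} (hμ : 0 < μ) {f : Vec d → ℝ}
    (hdiff : Differentiable ℝ f) {Lg L : ℝ≥0} (hgrad : LipschitzWith Lg (gradient f))
    (hf : LipschitzWith L f) (x : Vec d) (i : Fin d) :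
    ∫ u, zoGrad μ f x u i ^ 2 ∂uniformSphere d ≤ 6 * L ^ 2 + d * μ ^ 2 * Lg ^ 2 / 2 := by
  have hI : ∀ {g : Vec d → ℝ}, Continuous g → Integrable g (uniformSphere d) :=
    fun hg => Continuous.integrable_uniformSphere hd hg
  have hd0 : (0 : ℝ) < d := by positivity
  have hcont := hdiff.continuous
  calc ∫ u, zoGrad μ f x u i ^ 2 ∂uniformSphere d
      ≤ ∫ u : Vec d, 2 * d ^ 2 * (inner ℝ (gradient f x) u ^ 2 * u i ^ 2)
        + d ^ 2 * μ ^ 2 * Lg ^ 2 / 2 * u i ^ 2 ∂uniformSphere d := by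
        refine integral_mono_ae (hI ?_) (hI (by fun_prop)) ?_
        · exact (continuous_zoGrad_apply μ hcont x i).pow 2
        · filter_upwards [ae_norm_eq_one_uniformSphere d] with u hu
          have h := abs_sub_sub_inner_gradient_le hdiff hgrad x (μ • u)
          rw [inner_smul_right, norm_smul, hu, mul_one, Real.norm_of_nonneg hμ.le] at h
          set A := f (x + μ • u) - f x
          set b := inner ℝ (gradient f x) u
          have h1 : A ^ 2 ≤ 2 * (μ * b) ^ 2 + 2 * (Lg / 2 * μ ^ 2) ^ 2 := by
            have h2 : (A - μ * b) ^ 2 ≤ (Lg / 2 * μ ^ 2) ^ 2 := sq_le_sq' (by linarith [abs_le.1 h]) (abs_le.1 h).2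
            nlinarith [sq_nonneg (A - 2 * (μ * b))]
          rw [zoGrad_apply]
          calc ((d : ℝ) / μ * A * u i) ^ 2 = (d / μ) ^ 2 * u i ^ 2 * A ^ 2 := by ring
            _ ≤ (d / μ) ^ 2 * u i ^ 2 * (2 * (μ * b) ^ 2 + 2 * (Lg / 2 * μ ^ 2) ^ 2) := by gcongr
            _ = _ := by field_simp
    _ = 2 * d ^ 2 * (∫ u : Vec d, inner ℝ (gradient f x) u ^ 2 * u i ^ 2 ∂uniformSphere d)
        + d ^ 2 * μ ^ 2 * Lg ^ 2 / 2 * ∫ u : Vec d, u i ^ 2 ∂uniformSphere d := by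
        rw [integral_add (hI (by fun_prop)) (hI (by fun_prop)), integral_const_mul,
          integral_const_mul]
    _ ≤ 2 * d ^ 2 * (3 * L ^ 2 / d ^ 2) + d ^ 2 * μ ^ 2 * Lg ^ 2 / 2 * (1 / d) := by
        rw [integral_uniformSphere_coord_sq hd]
        gcongr
        exact integral_uniformSphere_inner_sq_mul_coord_sq_le hd (hf.norm_gradient_le x) i
    _ = _ := by field_simp; ring

/-- The linear part is unbiased because d·E[uuᵀ] = I. The Taylor remainder, at most Lg μ²/2, is
multiplied by d/μ. -/
theorem inner_gradient_sub_le_integral_inner_zoGrad {d : ℕ} (hd : 1 ≤ d) {μ : ℝ} (hμ : 0 < μ)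
    {f : Vec d → ℝ} (hdiff : Differentiable ℝ f) {Lg : ℝ≥0}
    (hgrad : LipschitzWith Lg (gradient f)) (x w : Vec d) :
    inner ℝ w (gradient f x) - d * μ * Lg / 2 * ‖w‖ ≤
      ∫ u, inner ℝ w (zoGrad μ f x u) ∂uniformSphere d := by
  have := isProbabilityMeasure_uniformSphere hd
  have hI : ∀ {g : Vec d → ℝ}, Continuous g → Integrable g (uniformSphere d) :=
    fun hg => Continuous.integrable_uniformSphere hd hg
  have hd0 : (0 : ℝ) < d := by positivity
  have hcont := hdiff.continuous
  have h1 : inner ℝ w (gradient f x) - d * μ * Lg / 2 * ‖w‖ =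
      ∫ u, (d * (inner ℝ w u * inner ℝ (gradient f x) u) - d * μ * Lg / 2 * ‖w‖)
        ∂uniformSphere d := by
    rw [integral_sub (hI (by fun_prop)) (integrable_const _), integral_const_mul,
      integral_uniformSphere_inner_mul_inner hd]
    simp
    field_simp
  rw [h1]
  refine integral_mono_ae (hI (by fun_prop)) (hI ?_) ?_
  · simp only [zoGrad]
    fun_prop
  · filter_upwards [ae_norm_eq_one_uniformSphere d] with u hu
    have h := abs_sub_sub_inner_gradient_le hdiff hgrad x (μ • u)
    rw [inner_smul_right, norm_smul, hu, mul_one, Real.norm_of_nonneg hμ.le] at h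
    set A := f (x + μ • u) - f x
    set b := inner ℝ (gradient f x) u
    have hw : |inner ℝ w u| ≤ ‖w‖ := by simpa [hu] using abs_real_inner_le_norm w u
    rw [zoGrad, inner_smul_right]
    have h3 : |(A - μ * b) * inner ℝ w u| ≤ Lg / 2 * μ ^ 2 * ‖w‖ := by
      rw [abs_mul]
      gcongr
    have h4 := (abs_le.1 h3).1
    have h5 : d / μ * (-(Lg / 2 * μ ^ 2 * ‖w‖)) ≤ d / μ * ((A - μ * b) * inner ℝ w u) := by gcongr
    have h6 : d / μ * ((A - μ * b) * inner ℝ w u)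
        = d / μ * A * inner ℝ w u - d * (inner ℝ w u * b) := by field_simp
    have h7 : d / μ * (-(Lg / 2 * μ ^ 2 * ‖w‖)) = -(d * μ * Lg / 2 * ‖w‖) := by field_simp
    linarith

theorem measurable_uncurry_of_lipschitz {d : ℕ} {Ξ : Type*} [MeasurableSpace Ξ]
    {F : Vec d → Ξ → ℝ} (hmeas : ∀ x, Measurable (F x)) {L : ℝ≥0}
    (hlip : ∀ s, LipschitzWith L fun x => F x s) : Measurable (Function.uncurry F) :=
  measurable_uncurry_of_continuous_of_measurable (fun s => (hlip s).continuous) hmeas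

/-! ### Averaging the estimate over the sample as well as the direction. -/

section Stochastic

variable {d : ℕ} {Ξ : Type*} [MeasurableSpace Ξ] {ν : Measure Ξ} [IsProbabilityMeasure ν]
  {F : Vec d → Ξ → ℝ} {L Lg : ℝ≥0} {μ : ℝ}

theorem measurable_zoGrad {Ω : Type*} [MeasurableSpace Ω] (hF : Measurable (Function.uncurry F))
    {x u : Ω → Vec d} {ξ : Ω → Ξ} (hx : Measurable x) (hu : Measurable u) (hξ : Measurable ξ) :
    Measurable fun ω => zoGrad μ (fun y => F y (ξ ω)) (x ω) (u ω) := by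
  unfold zoGrad
  have h1 : Measurable fun ω => F (x ω + μ • u ω) (ξ ω) :=
    hF.comp (f := fun ω => (x ω + μ • u ω, ξ ω)) (by fun_prop)
  have h2 : Measurable fun ω => F (x ω) (ξ ω) := hF.comp (f := fun ω => (x ω, ξ ω)) (by fun_prop)
  exact ((h1.sub h2).const_mul _).smul hu

theorem ae_prod_uniformSphere_norm (hd : 1 ≤ d) (ν : Measure Ξ) [IsProbabilityMeasure ν] :
    ∀ᵐ z ∂ν.prod (uniformSphere d), ‖z.2‖ = 1 := by
  have := isProbabilityMeasure_uniformSphere hd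
  exact Measure.quasiMeasurePreserving_snd.ae (ae_norm_eq_one_uniformSphere d)

theorem integrable_zoGrad_apply_sq (hd : 1 ≤ d) (hμ : 0 < μ) (hmeas : ∀ x, Measurable (F x))
    (hlip : ∀ s, LipschitzWith L fun x => F x s) (x : Vec d) (i : Fin d) :
    Integrable (fun z : Ξ × Vec d => zoGrad μ (fun y => F y z.1) x z.2 i ^ 2)
      (ν.prod (uniformSphere d)) := by
  have := isProbabilityMeasure_uniformSphere hd
  have hm : Measurable fun z : Ξ × Vec d => zoGrad μ (fun y => F y z.1) x z.2 :=
    measurable_zoGrad (measurable_uncurry_of_lipschitz hmeas hlip) measurable_const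
      measurable_snd measurable_fst
  refine Integrable.of_bound (C := (d * L) ^ 2)
    (((by fun_prop : Measurable fun v : Vec d => v i ^ 2).comp hm).aestronglyMeasurable) ?_
  filter_upwards [ae_prod_uniformSphere_norm hd ν] with z hz
  rw [norm_pow]
  gcongr
  exact (PiLp.norm_apply_le _ i).trans (norm_zoGrad_le hμ (hlip _) x hz)

theorem integral_prod_zoGrad_apply_sq_le (hd : 1 ≤ d) (hμ : 0 < μ)
    (hmeas : ∀ x, Measurable (F x)) (hdiff : ∀ s, Differentiable ℝ fun x => F x s)
    (hgrad : ∀ s, LipschitzWith Lg (gradient fun x => F x s))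
    (hlip : ∀ s, LipschitzWith L fun x => F x s) (x : Vec d) (i : Fin d) :
    ∫ z, zoGrad μ (fun y => F y z.1) x z.2 i ^ 2 ∂ν.prod (uniformSphere d)
      ≤ 6 * L ^ 2 + d * μ ^ 2 * Lg ^ 2 / 2 := by
  have := isProbabilityMeasure_uniformSphere hd
  have hint := integrable_zoGrad_apply_sq (ν := ν) hd hμ hmeas hlip x i
  rw [integral_prod _ hint]
  calc _ ≤ ∫ _s, (6 * (L : ℝ) ^ 2 + d * μ ^ 2 * Lg ^ 2 / 2) ∂ν :=
        integral_mono hint.integral_prod_left (integrable_const _) fun s =>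
          integral_zoGrad_apply_sq_le hd hμ (hdiff s) (hgrad s) (hlip s) x i
    _ = _ := by simp

theorem inner_gradient_sub_le_integral_prod (hd : 1 ≤ d) (hμ : 0 < μ)
    (hint : ∀ x, Integrable (F x) ν) (hmeas : ∀ x, Measurable (F x))
    (hdiff : ∀ s, Differentiable ℝ fun x => F x s)
    (hgrad : ∀ s, LipschitzWith Lg (gradient fun x => F x s))
    (hlip : ∀ s, LipschitzWith L fun x => F x s) (x w : Vec d) :
    inner ℝ w (gradient (objective ν F) x) - d * μ * Lg / 2 * ‖w‖ ≤
      ∫ z, inner ℝ w (zoGrad μ (fun y => F y z.1) x z.2) ∂ν.prod (uniformSphere d) := by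
  have := isProbabilityMeasure_uniformSphere hd
  have hm : Measurable fun z : Ξ × Vec d => zoGrad μ (fun y => F y z.1) x z.2 :=
    measurable_zoGrad (measurable_uncurry_of_lipschitz hmeas hlip) measurable_const
      measurable_snd measurable_fst
  have hI : Integrable (fun z : Ξ × Vec d => inner ℝ w (zoGrad μ (fun y => F y z.1) x z.2))
      (ν.prod (uniformSphere d)) := by
    refine Integrable.of_bound (C := ‖w‖ * (d * L))
      (((by fun_prop : Measurable fun v : Vec d => inner ℝ w v).comp hm).aestronglyMeasurable) ?_
    filter_upwards [ae_prod_uniformSphere_norm hd ν] with z hz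
    refine (norm_inner_le_norm _ _).trans ?_
    gcongr
    exact norm_zoGrad_le hμ (hlip _) x hz
  -- The sample is integrated out first: the estimate is linear in the function, so this gives the
  -- estimate of the expected loss.
  rw [integral_prod_symm _ hI]
  have h : ∀ u : Vec d, ∫ s, inner ℝ w (zoGrad μ (fun y => F y s) x u) ∂ν
      = inner ℝ w (zoGrad μ (objective ν F) x u) := by
    intro u
    simp only [zoGrad, inner_smul_right, objective]
    rw [integral_mul_const, integral_const_mul, integral_sub (hint _) (hint _)]
  simp_rw [h]
  exact inner_gradient_sub_le_integral_inner_zoGrad hd hμ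
    (differentiable_objective hint hmeas hdiff hlip)
    (lipschitzWith_gradient_objective hint hmeas hdiff hgrad hlip) x w

end Stochastic

/-! ### One-step expectations with random iterate and weight. -/

/-- Plays the role of conditioning on the past: independence makes the joint law a product, and
Fubini integrates Z out with Y frozen. -/
theorem integral_comp_prodMk_of_indepFun {Ω 𝒴 𝒵 : Type*} [MeasurableSpace Ω] [MeasurableSpace 𝒴]
    [MeasurableSpace 𝒵] {P : Measure Ω} [IsProbabilityMeasure P] {Y : Ω → 𝒴} {Z : Ω → 𝒵}
    (hY : Measurable Y) (hZ : Measurable Z) (h : IndepFun Y Z P) {Φ : 𝒴 × 𝒵 → ℝ}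
    (hΦ : Measurable Φ) (hint : Integrable (fun ω => Φ (Y ω, Z ω)) P) :
    Integrable (fun ω => ∫ z, Φ (Y ω, z) ∂P.map Z) P ∧
    ∫ ω, Φ (Y ω, Z ω) ∂P = ∫ ω, ∫ z, Φ (Y ω, z) ∂P.map Z ∂P := by
  have hYm := hY.aemeasurable (μ := P)
  have hprod := (indepFun_iff_map_prod_eq_prod_map_map hYm hZ.aemeasurable).1 h
  have := Measure.isProbabilityMeasure_map (μ := P) hZ.aemeasurable
  have := Measure.isProbabilityMeasure_map (μ := P) hYm
  have hint' : Integrable Φ ((P.map Y).prod (P.map Z)) := by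
    rw [← hprod, integrable_map_measure hΦ.aestronglyMeasurable (hY.prodMk hZ).aemeasurable]
    exact hint
  refine ⟨hint'.integral_prod_left.comp_measurable hY, ?_⟩
  have h1 : ∫ ω, Φ (Y ω, Z ω) ∂P = ∫ p, Φ p ∂((P.map Y).prod (P.map Z)) := by
    rw [← hprod, integral_map (hY.prodMk hZ).aemeasurable hΦ.aestronglyMeasurable]
  rw [h1, integral_prod _ hint', integral_map hYm hint'.integral_prod_left.aestronglyMeasurable]

section OneStep

variable {d : ℕ} {Ξ : Type*} [MeasurableSpace Ξ] {ν : Measure Ξ} [IsProbabilityMeasure ν]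
  {F : Vec d → Ξ → ℝ} {L Lg : ℝ≥0} {μ : ℝ}
  {Ω : Type*} [MeasurableSpace Ω] {P : Measure Ω} [IsProbabilityMeasure P]
  {X w u : Ω → Vec d} {ξ : Ω → Ξ}

theorem integrable_inner_zoGrad (hμ : 0 < μ) (hmeas : ∀ x, Measurable (F x))
    (hlip : ∀ s, LipschitzWith L fun x => F x s)
    (hX : Measurable X) (hw : Measurable w) (hξ : Measurable ξ) (hu : Measurable u)
    (hu1 : ∀ᵐ ω ∂P, ‖u ω‖ = 1) {M : ℝ} (hM : ∀ ω, ‖w ω‖ ≤ M) :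
    Integrable (fun ω => inner ℝ (w ω) (zoGrad μ (fun y => F y (ξ ω)) (X ω) (u ω))) P := by
  have hg := measurable_zoGrad (μ := μ) (measurable_uncurry_of_lipschitz hmeas hlip) hX hu hξ
  refine Integrable.of_bound (C := M * (d * L)) (hw.inner hg).aestronglyMeasurable ?_
  filter_upwards [hu1] with ω h1
  refine (norm_inner_le_norm _ _).trans ?_
  have := norm_zoGrad_le hμ (hlip (ξ ω)) (X ω) h1
  have h0 := (norm_nonneg _).trans (hM ω)
  gcongr
  exact hM ω

theorem integrable_sum_mul_zoGrad_sq (hμ : 0 < μ) (hmeas : ∀ x, Measurable (F x))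
    (hlip : ∀ s, LipschitzWith L fun x => F x s)
    (hX : Measurable X) (hw : Measurable w) (hξ : Measurable ξ) (hu : Measurable u)
    (hu1 : ∀ᵐ ω ∂P, ‖u ω‖ = 1) {M : ℝ} (hM : ∀ ω, ‖w ω‖ ≤ M) :
    Integrable (fun ω => ∑ i, (w ω i * zoGrad μ (fun y => F y (ξ ω)) (X ω) (u ω) i) ^ 2) P := by
  have hg := measurable_zoGrad (μ := μ) (measurable_uncurry_of_lipschitz hmeas hlip) hX hu hξ
  refine integrable_finsetSum _ fun i _ => ?_
  refine Integrable.of_bound (C := (M * (d * L)) ^ 2) (Measurable.aestronglyMeasurable ?_) ?_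
  · have h1 : Measurable fun ω => w ω i := (by fun_prop : Measurable fun v : Vec d => v i).comp hw
    have h2 : Measurable fun ω => zoGrad μ (fun y => F y (ξ ω)) (X ω) (u ω) i :=
      (by fun_prop : Measurable fun v : Vec d => v i).comp hg
    exact (h1.mul h2).pow_const 2
  filter_upwards [hu1] with ω h1
  have h2 := norm_zoGrad_le hμ (hlip (ξ ω)) (X ω) h1
  have h0 := (norm_nonneg _).trans (hM ω)
  rw [norm_pow, norm_mul]
  gcongr
  · exact (PiLp.norm_apply_le _ i).trans (hM ω)
  · exact (PiLp.norm_apply_le _ i).trans h2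

theorem integral_inner_gradient_sub_le (hd : 1 ≤ d) (hμ : 0 < μ)
    (hint : ∀ x, Integrable (F x) ν) (hmeas : ∀ x, Measurable (F x))
    (hdiff : ∀ s, Differentiable ℝ fun x => F x s)
    (hgrad : ∀ s, LipschitzWith Lg (gradient fun x => F x s))
    (hlip : ∀ s, LipschitzWith L fun x => F x s)
    (hX : Measurable X) (hw : Measurable w) (hξ : Measurable ξ) (hu : Measurable u)
    (hlaw : P.map (fun ω => (ξ ω, u ω)) = ν.prod (uniformSphere d))
    (hindep : IndepFun (fun ω => (X ω, w ω)) (fun ω => (ξ ω, u ω)) P)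
    (hu1 : ∀ᵐ ω ∂P, ‖u ω‖ = 1) {M : ℝ} (hM : ∀ ω, ‖w ω‖ ≤ M) :
    ∫ ω, inner ℝ (w ω) (gradient (objective ν F) (X ω)) ∂P - d * μ * Lg / 2 * M ≤
      ∫ ω, inner ℝ (w ω) (zoGrad μ (fun y => F y (ξ ω)) (X ω) (u ω)) ∂P := by
  have hgm : Measurable (gradient (objective ν F)) :=
    (lipschitzWith_gradient_objective hint hmeas hdiff hgrad hlip).continuous.measurable
  have hG := lipschitzWith_objective hint hlip
  have hI : Integrable (fun ω => inner ℝ (w ω) (gradient (objective ν F) (X ω))) P := by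
    refine Integrable.of_bound (C := M * L) (hw.inner (hgm.comp hX)).aestronglyMeasurable
      (Filter.Eventually.of_forall fun ω => (norm_inner_le_norm _ _).trans ?_)
    have h0 := (norm_nonneg _).trans (hM ω)
    gcongr
    · exact hM ω
    · exact hG.norm_gradient_le _
  let Φ : (Vec d × Vec d) × (Ξ × Vec d) → ℝ := fun p =>
    inner ℝ p.1.2 (zoGrad μ (fun y => F y p.2.1) p.1.1 p.2.2)
  have hΦ : Measurable Φ := by
    refine Measurable.inner (by fun_prop) ?_
    exact measurable_zoGrad (measurable_uncurry_of_lipschitz hmeas hlip) (by fun_prop)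
      (by fun_prop) (by fun_prop)
  have key := integral_comp_prodMk_of_indepFun (hX.prodMk hw) (hξ.prodMk hu) hindep hΦ
    (integrable_inner_zoGrad hμ hmeas hlip hX hw hξ hu hu1 hM)
  rw [hlaw] at key
  refine le_trans ?_ key.2.ge
  have hc : d * μ * Lg / 2 * M = ∫ _ω, d * μ * Lg / 2 * M ∂P := by simp
  rw [hc, ← integral_sub hI (integrable_const _)]
  refine integral_mono (hI.sub (integrable_const _)) key.1 fun ω => ?_
  refine le_trans ?_
    (inner_gradient_sub_le_integral_prod hd hμ hint hmeas hdiff hgrad hlip (X ω) (w ω))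
  dsimp only
  have := hM ω
  gcongr

/-- The coordinatewise second moment makes the bound proportional to ‖w‖². It is used with w the
all-ones vector, for ‖ĝ‖², and with w the gradient, for ‖q‖². -/
theorem integral_sum_mul_zoGrad_sq_le (hd : 1 ≤ d) (hμ : 0 < μ)
    (hmeas : ∀ x, Measurable (F x))
    (hdiff : ∀ s, Differentiable ℝ fun x => F x s)
    (hgrad : ∀ s, LipschitzWith Lg (gradient fun x => F x s))
    (hlip : ∀ s, LipschitzWith L fun x => F x s)
    (hX : Measurable X) (hw : Measurable w) (hξ : Measurable ξ) (hu : Measurable u)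
    (hlaw : P.map (fun ω => (ξ ω, u ω)) = ν.prod (uniformSphere d))
    (hindep : IndepFun (fun ω => (X ω, w ω)) (fun ω => (ξ ω, u ω)) P)
    (hu1 : ∀ᵐ ω ∂P, ‖u ω‖ = 1) {M : ℝ} (hM : ∀ ω, ‖w ω‖ ≤ M) :
    ∫ ω, ∑ i, (w ω i * zoGrad μ (fun y => F y (ξ ω)) (X ω) (u ω) i) ^ 2 ∂P
      ≤ (6 * L ^ 2 + d * μ ^ 2 * Lg ^ 2 / 2) * M ^ 2 := by
  let Φ : (Vec d × Vec d) × (Ξ × Vec d) → ℝ := fun p =>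
    ∑ i, (p.1.2 i * zoGrad μ (fun y => F y p.2.1) p.1.1 p.2.2 i) ^ 2
  have hΦ : Measurable Φ := by
    have hg : Measurable fun p : (Vec d × Vec d) × (Ξ × Vec d) =>
        zoGrad μ (fun y => F y p.2.1) p.1.1 p.2.2 :=
      measurable_zoGrad (measurable_uncurry_of_lipschitz hmeas hlip) (by fun_prop)
        (by fun_prop) (by fun_prop)
    refine Finset.measurable_fun_sum _ fun i _ => ?_
    have h2 : Measurable fun p : (Vec d × Vec d) × (Ξ × Vec d) =>
        zoGrad μ (fun y => F y p.2.1) p.1.1 p.2.2 i :=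
      (by fun_prop : Measurable fun v : Vec d => v i).comp hg
    have h1 : Measurable fun p : (Vec d × Vec d) × (Ξ × Vec d) => p.1.2 i := by fun_prop
    exact (h1.mul h2).pow_const 2
  have key := integral_comp_prodMk_of_indepFun (hX.prodMk hw) (hξ.prodMk hu) hindep hΦ
    (integrable_sum_mul_zoGrad_sq hμ hmeas hlip hX hw hξ hu hu1 hM)
  rw [hlaw] at key
  refine key.2.le.trans ?_
  have hc : (6 * (L : ℝ) ^ 2 + d * μ ^ 2 * Lg ^ 2 / 2) * M ^ 2
      = ∫ _ω, (6 * (L : ℝ) ^ 2 + d * μ ^ 2 * Lg ^ 2 / 2) * M ^ 2 ∂P := by simp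
  rw [hc]
  refine integral_mono key.1 (integrable_const _) fun ω => ?_
  simp only [Φ, mul_pow]
  rw [integral_finsetSum _ fun i _ =>
    (integrable_zoGrad_apply_sq hd hμ hmeas hlip (X ω) i).const_mul _]
  simp_rw [integral_const_mul]
  calc _ ≤ ∑ i, w ω i ^ 2 * (6 * (L : ℝ) ^ 2 + d * μ ^ 2 * Lg ^ 2 / 2) := by
        gcongr with i
        exact integral_prod_zoGrad_apply_sq_le hd hμ hmeas hdiff hgrad hlip _ _
    _ = (6 * (L : ℝ) ^ 2 + d * μ ^ 2 * Lg ^ 2 / 2) * ‖w ω‖ ^ 2 := by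
        rw [← Finset.sum_mul, EuclideanSpace.real_norm_sq_eq, mul_comm]
    _ ≤ _ := by
        have := hM ω
        gcongr

end OneStep

/-! ### The pathwise estimate for ZO-AdaMM. -/

namespace AdaMMInput

variable {d : ℕ} {Ξ : Type*}

/-- The diagonal of `V̂_t^{-1/2}`. -/
noncomputable def scaling (I : AdaMMInput d) (F : Vec d → Ξ → ℝ) (ξ : ℕ → Ξ) (u : ℕ → Vec d)
    (t : ℕ) (i : Fin d) : ℝ :=
  1 / √(I.vhat F ξ u t i)

section Path

variable (I : AdaMMInput d) (F : Vec d → Ξ → ℝ) (ξ : ℕ → Ξ) (u : ℕ → Vec d)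

theorem vhat_mono (i : Fin d) : Monotone fun t => I.vhat F ξ u t i :=
  monotone_nat_of_le_succ fun _ => le_max_left _ _

variable {I} {c : ℝ}

theorem le_sqrt_vhat (hI : ∀ i, c ≤ √(I.vhat₀ i)) (t : ℕ) (i : Fin d) :
    c ≤ √(I.vhat F ξ u t i) :=
  (hI i).trans (Real.sqrt_le_sqrt (I.vhat_mono F ξ u i (Nat.zero_le t)))

theorem scaling_nonneg (t : ℕ) (i : Fin d) : 0 ≤ I.scaling F ξ u t i := by
  unfold scaling; positivity

theorem scaling_le (hc : 0 < c) (hI : ∀ i, c ≤ √(I.vhat₀ i)) (t : ℕ) (i : Fin d) :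
    I.scaling F ξ u t i ≤ 1 / c :=
  one_div_le_one_div_of_le hc (le_sqrt_vhat F ξ u hI t i)

theorem scaling_succ_le (hc : 0 < c) (hI : ∀ i, c ≤ √(I.vhat₀ i)) (t : ℕ) (i : Fin d) :
    I.scaling F ξ u (t + 1) i ≤ I.scaling F ξ u t i :=
  one_div_le_one_div_of_le (hc.trans_le (le_sqrt_vhat F ξ u hI t i))
    (Real.sqrt_le_sqrt (I.vhat_mono F ξ u i t.le_succ))

theorem gradMeasure_eq_sum (hc : 0 < c) (hI : ∀ i, c ≤ √(I.vhat₀ i)) (f : Vec d → ℝ) (t : ℕ) :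
    I.gradMeasure F f ξ u t
      = ∑ i, I.scaling F ξ u t i * gradient f (I.iterate F ξ u t) i ^ 2 := by
  rw [gradMeasure, EuclideanSpace.real_norm_sq_eq]
  refine Finset.sum_congr rfl fun i _ => ?_
  have hv : 0 < I.vhat F ξ u t i := Real.sqrt_pos.1 (hc.trans_le (le_sqrt_vhat F ξ u hI t i))
  rw [mul_pow, scaling, ← Real.rpow_natCast, ← Real.rpow_mul hv.le, Real.sqrt_eq_rpow,
    show (-(1 / 4) : ℝ) * (2 : ℕ) = -(1 / 2) by norm_num, Real.rpow_neg hv.le]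
  simp only [one_div]

/-- Monotonicity of v̂ lets the scaling at time t, which is independent of the next sample and
direction, replace the one at time t+1. -/
theorem gradMeasure_succ_le (hc : 0 < c) (hI : ∀ i, c ≤ √(I.vhat₀ i)) (f : Vec d → ℝ) (t : ℕ) :
    I.gradMeasure F f ξ u (t + 1)
      ≤ inner ℝ (WithLp.toLp 2 fun i => I.scaling F ξ u t i
          * gradient f (I.iterate F ξ u (t + 1)) i : Vec d) (gradient f (I.iterate F ξ u (t + 1))) := by
  rw [gradMeasure_eq_sum F ξ u hc hI, PiLp.inner_apply]
  refine Finset.sum_le_sum fun i _ => ?_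
  simp only [RCLike.inner_apply, conj_trivial]
  have := scaling_succ_le F ξ u hc hI t i
  calc _ ≤ I.scaling F ξ u t i * gradient f (I.iterate F ξ u (t + 1)) i ^ 2 := by gcongr
    _ = _ := by ring

theorem norm_scaling_mul_le (hc : 0 < c) (hI : ∀ i, c ≤ √(I.vhat₀ i)) (t : ℕ) (v : Vec d) :
    ‖(WithLp.toLp 2 fun i => I.scaling F ξ u t i * v i : Vec d)‖ ≤ 1 / c * ‖v‖ := by
  rw [← sq_le_sq₀ (norm_nonneg _) (by positivity), mul_pow, EuclideanSpace.real_norm_sq_eq,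
    EuclideanSpace.real_norm_sq_eq, Finset.mul_sum]
  refine Finset.sum_le_sum fun i _ => ?_
  have := scaling_le F ξ u hc hI t i
  have := scaling_nonneg (I := I) F ξ u t i
  dsimp only
  rw [mul_pow]
  gcongr

theorem sum_inner_ghat_le {f : Vec d → ℝ} (hf : Differentiable ℝ f) {Lg L : ℝ≥0}
    (hgrad : LipschitzWith Lg (gradient f)) (hlip : LipschitzWith L f)
    {α β lam : ℝ} (hα : 0 < α) (hβ : 0 ≤ β) (hβ1 : β < 1) (hlam : 0 < lam)
    (hc : 0 < c) (hI : ∀ i, c ≤ √(I.vhat₀ i))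
    (hIα : ∀ t, I.α t = α) (hIβ : ∀ t, I.β₁ t = β) (T : ℕ) :
    (1 - β) ^ 2 * ∑ t ∈ Finset.range T,
        inner ℝ (WithLp.toLp 2 fun i => I.scaling F ξ u t i
          * gradient f (I.iterate F ξ u (t + 1)) i : Vec d) (I.ghat F ξ u (t + 1)) ≤
      (f I.x₁ - f (I.iterate F ξ u (T + 1))) * (1 - β) ^ 2 / α + 1 / c * L / 2 / α
      + lam * (1 / c) ^ 2 * d / 2
      + (5 / 2 * Lg * (1 / c) ^ 2 + 1 / c * L / 2) * α
        * ∑ t ∈ Finset.range T, ∑ i, (1 * I.ghat F ξ u (t + 1) i) ^ 2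
      + 1 / (2 * lam) * ∑ t ∈ Finset.range T,
        ∑ i, (gradient f (I.iterate F ξ u (t + 1)) i * I.ghat F ξ u (t + 1) i) ^ 2 := by
  let m : ℕ → Vec d := fun t => (I.state F ξ u t).m
  let N : ℕ → Vec d := fun t => gradient f (I.iterate F ξ u (t + 1))
  let D := I.scaling F ξ u
  have hm : ∀ t, m (t + 1) = β • m t + (1 - β) • I.ghat F ξ u (t + 1) := by
    intro t
    have h : m (t + 1) = I.β₁ (t + 1) • m t + (1 - I.β₁ (t + 1)) • I.ghat F ξ u (t + 1) := rfl
    rw [h, hIβ]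
  have hx : ∀ t, I.iterate F ξ u (t + 2) = I.iterate F ξ u (t + 1)
      + (-α) • (WithLp.toLp 2 fun i => D (t + 1) i * m (t + 1) i : Vec d) := by
    intro t
    ext i
    have h : I.iterate F ξ u (t + 2) i = I.iterate F ξ u (t + 1) i
        - I.α (t + 1) * (m (t + 1) i / √(I.vhat F ξ u (t + 1) i)) := rfl
    rw [h, hIα]
    simp only [D, scaling, PiLp.add_apply, PiLp.smul_apply, smul_eq_mul]
    ring
  have hdm : ∀ t, ‖(WithLp.toLp 2 fun i => D (t + 1) i * m (t + 1) i : Vec d)‖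
      ≤ 1 / c * ‖m (t + 1)‖ := fun t => norm_scaling_mul_le F ξ u hc hI _ _
  have hstep : ∀ t, ‖(-α) • (WithLp.toLp 2 fun i => D (t + 1) i * m (t + 1) i : Vec d)‖
      ≤ α * (1 / c) * ‖m (t + 1)‖ := by
    intro t
    rw [norm_smul, norm_neg, Real.norm_of_nonneg hα.le, mul_assoc]
    gcongr
    exact hdm t
  have key := sum_scaled_inner_le (N := N) (m := m) (g := I.ghat F ξ u)
    (q := fun t => WithLp.toLp 2 fun i => N (t - 1) i * I.ghat F ξ u t i) (D := D)
    (φ := fun t => f (I.iterate F ξ u (t + 1))) (α := α) (β := β) (B := 1 / c) (L := Lg) (G := L)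
    (lam := lam) hα hβ hβ1 (by positivity) (by positivity) (by positivity) hlam
    (scaling_nonneg F ξ u) (scaling_le F ξ u hc hI) (scaling_succ_le F ξ u hc hI) rfl hm
    (fun t => hlip.norm_gradient_le _)
    (fun t => by
      refine (hgrad.norm_sub_le _ _).trans ?_
      gcongr
      rw [hx, add_sub_cancel_left]
      exact hstep t)
    (fun t i => rfl)
    (fun t => by
      have h1 := le_quadratic_of_lipschitz_gradient hf hgrad (I.iterate F ξ u (t + 1))
        ((-α) • (WithLp.toLp 2 fun i => D (t + 1) i * m (t + 1) i : Vec d))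
      rw [← hx, inner_smul_right, PiLp.inner_apply] at h1
      refine h1.trans ?_
      have h2 := hstep t
      have h3 : ∑ i, inner ℝ (gradient f (I.iterate F ξ u (t + 1)) i) (D (t + 1) i * m (t + 1) i)
          = ∑ i, D (t + 1) i * (N t i * m (t + 1) i) := by
        refine Finset.sum_congr rfl fun i _ => ?_
        simp only [RCLike.inner_apply, conj_trivial, N]
        ring
      dsimp only
      rw [h3, neg_mul, ← sub_eq_add_neg]
      gcongr) T
  simp only [EuclideanSpace.real_norm_sq_eq] at key
  have e : ∀ t, inner ℝ (WithLp.toLp 2 fun i => I.scaling F ξ u t i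
      * gradient f (I.iterate F ξ u (t + 1)) i : Vec d) (I.ghat F ξ u (t + 1))
      = ∑ i, D t i * (N t i * I.ghat F ξ u (t + 1) i) := by
    intro t
    rw [PiLp.inner_apply]
    refine Finset.sum_congr rfl fun i _ => ?_
    simp only [RCLike.inner_apply, conj_trivial, N, D]
    ring
  simp only [one_mul, e]
  exact key

end Path

end AdaMMInput

/-! ### Measurability and boundedness along the iteration. -/

namespace AdaMMInput

variable {d : ℕ} {Ξ : Type*}

/-- Only the noise up to time t is assumed measurable, and the σ-algebra on Ω is arbitrary. Taking
the one generated by that noise yields adaptedness. -/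
theorem measurable_state [MeasurableSpace Ξ] (I : AdaMMInput d) {F : Vec d → Ξ → ℝ}
    (hF : Measurable (Function.uncurry F)) {Ω : Type*} [MeasurableSpace Ω]
    {ξ : ℕ → Ω → Ξ} {u : ℕ → Ω → Vec d} (t : ℕ)
    (hξ : ∀ s ≤ t, Measurable (ξ s)) (hu : ∀ s ≤ t, Measurable (u s)) :
    (Measurable fun ω => (I.state F (fun t => ξ t ω) (fun t => u t ω) t).x) ∧
    (Measurable fun ω => (I.state F (fun t => ξ t ω) (fun t => u t ω) t).m) ∧
    (Measurable fun ω => (I.state F (fun t => ξ t ω) (fun t => u t ω) t).v) ∧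
    (Measurable fun ω => (I.state F (fun t => ξ t ω) (fun t => u t ω) t).vhat) := by
  induction t with
  | zero => exact ⟨measurable_const, measurable_const, measurable_const, measurable_const⟩
  | succ t ih =>
    obtain ⟨hx, hm, hv, hw⟩ := ih (fun s hs => hξ s (hs.trans t.le_succ))
      (fun s hs => hu s (hs.trans t.le_succ))
    have hg := measurable_zoGrad (μ := I.μ) hF hx (hu (t + 1) le_rfl) (hξ (t + 1) le_rfl)
    have hcoord : ∀ i : Fin d, Measurable fun v : Vec d => v i := fun i => by fun_prop
    have hm' : Measurable fun ω =>
        (I.state F (fun t => ξ t ω) (fun t => u t ω) (t + 1)).m :=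
      (hm.const_smul (I.β₁ (t + 1))).add (hg.const_smul (1 - I.β₁ (t + 1)))
    have hv' : Measurable fun ω =>
        (I.state F (fun t => ξ t ω) (fun t => u t ω) (t + 1)).v := by
      refine measurable_pi_lambda _ fun i => ?_
      exact (((measurable_pi_apply i).comp hv).const_mul I.β₂).add
        ((((hcoord i).comp hg).pow_const 2).const_mul (1 - I.β₂))
    have hw' : Measurable fun ω =>
        (I.state F (fun t => ξ t ω) (fun t => u t ω) (t + 1)).vhat := by
      refine measurable_pi_lambda _ fun i => ?_
      exact ((measurable_pi_apply i).comp hw).max ((measurable_pi_apply i).comp hv')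
    refine ⟨?_, hm', hv', hw'⟩
    refine (WithLp.measurable_toLp 2 _).comp (measurable_pi_lambda _ fun i => ?_)
    exact ((hcoord i).comp hx).sub ((((hcoord i).comp hm').div
      (((measurable_pi_apply i).comp hw').sqrt)).const_mul (I.α (t + 1)))

theorem measurable_iterate_succ [MeasurableSpace Ξ] (I : AdaMMInput d) {F : Vec d → Ξ → ℝ}
    (hF : Measurable (Function.uncurry F)) {Ω : Type*} [MeasurableSpace Ω]
    {ξ : ℕ → Ω → Ξ} {u : ℕ → Ω → Vec d} (t : ℕ)
    (hξ : ∀ s ≤ t, Measurable (ξ s)) (hu : ∀ s ≤ t, Measurable (u s)) :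
    Measurable fun ω => I.iterate F (fun t => ξ t ω) (fun t => u t ω) (t + 1) :=
  (I.measurable_state hF t hξ hu).1

theorem measurable_scaling_mul_gradient [MeasurableSpace Ξ] (I : AdaMMInput d) {F : Vec d → Ξ → ℝ}
    (hF : Measurable (Function.uncurry F)) {f : Vec d → ℝ} (hf : Measurable (gradient f))
    {Ω : Type*} [MeasurableSpace Ω] {ξ : ℕ → Ω → Ξ} {u : ℕ → Ω → Vec d} (t : ℕ)
    (hξ : ∀ s ≤ t, Measurable (ξ s)) (hu : ∀ s ≤ t, Measurable (u s)) :
    Measurable fun ω => (WithLp.toLp 2 fun i =>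
      I.scaling F (fun t => ξ t ω) (fun t => u t ω) t i
        * gradient f (I.iterate F (fun t => ξ t ω) (fun t => u t ω) (t + 1)) i : Vec d) := by
  obtain ⟨hx, -, -, hw⟩ := I.measurable_state hF t hξ hu
  refine (WithLp.measurable_toLp 2 _).comp (measurable_pi_lambda _ fun i => ?_)
  have h1 : Measurable fun ω => (gradient f
      (I.iterate F (fun t => ξ t ω) (fun t => u t ω) (t + 1)) : Vec d) i :=
    (by fun_prop : Measurable fun v : Vec d => v i).comp (hf.comp hx)
  exact ((((measurable_pi_apply i).comp hw).sqrt).const_div 1).mul h1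

theorem measurable_gradMeasure [MeasurableSpace Ξ] (I : AdaMMInput d) {F : Vec d → Ξ → ℝ}
    (hF : Measurable (Function.uncurry F)) {f : Vec d → ℝ} (hf : Measurable (gradient f))
    {Ω : Type*} [MeasurableSpace Ω] {ξ : ℕ → Ω → Ξ} {u : ℕ → Ω → Vec d}
    (hξ : ∀ s, Measurable (ξ s)) (hu : ∀ s, Measurable (u s)) (t : ℕ) :
    Measurable fun ω => I.gradMeasure F f (fun t => ξ t ω) (fun t => u t ω) t := by
  have hx := (I.measurable_state hF (t - 1) (fun s _ => hξ s) (fun s _ => hu s)).1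
  have hw := (I.measurable_state hF t (fun s _ => hξ s) (fun s _ => hu s)).2.2.2
  refine Measurable.pow_const (Measurable.norm ((WithLp.measurable_toLp 2 _).comp
    (measurable_pi_lambda _ fun i => ?_))) 2
  have h1 : Measurable fun ω => (gradient f
      (I.iterate F (fun t => ξ t ω) (fun t => u t ω) t) : Vec d) i :=
    (by fun_prop : Measurable fun v : Vec d => v i).comp (hf.comp hx)
  exact (((measurable_pi_apply i).comp hw).pow_const _).mul h1

theorem gradMeasure_nonneg (I : AdaMMInput d) (F : Vec d → Ξ → ℝ) (f : Vec d → ℝ)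
    (ξ : ℕ → Ξ) (u : ℕ → Vec d) (t : ℕ) : 0 ≤ I.gradMeasure F f ξ u t := by
  unfold gradMeasure; positivity

theorem gradMeasure_le {I : AdaMMInput d} (F : Vec d → Ξ → ℝ) {f : Vec d → ℝ} {L : ℝ≥0}
    (hf : LipschitzWith L f) (ξ : ℕ → Ξ) (u : ℕ → Vec d) {c : ℝ} (hc : 0 < c)
    (hI : ∀ i, c ≤ √(I.vhat₀ i)) (t : ℕ) : I.gradMeasure F f ξ u t ≤ 1 / c * L ^ 2 := by
  rw [gradMeasure_eq_sum F ξ u hc hI]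
  calc _ ≤ ∑ i, 1 / c * gradient f (I.iterate F ξ u t) i ^ 2 := by
        gcongr with i
        exact scaling_le F ξ u hc hI t i
    _ = 1 / c * ‖gradient f (I.iterate F ξ u t)‖ ^ 2 := by
        rw [← Finset.mul_sum, EuclideanSpace.real_norm_sq_eq]
    _ ≤ _ := by
        have := hf.norm_gradient_le (I.iterate F ξ u t)
        gcongr

end AdaMMInput

/-! ### The unconditional rate. -/

theorem indepFun_of_measurable_past {Ω 𝒴 𝒵 : Type*} {mΩ : MeasurableSpace Ω} [MeasurableSpace 𝒵]
    [m𝒴 : MeasurableSpace 𝒴] {P : Measure Ω} {Z : ℕ → Ω → 𝒵} (hZ : ∀ t, Measurable (Z t))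
    (hindep : iIndepFun Z P) (t : ℕ) {Y : Ω → 𝒴}
    (hY : Measurable[⨆ s ∈ Set.Iic t, MeasurableSpace.comap (Z s) inferInstance] Y) :
    IndepFun Y (Z (t + 1)) P := by
  have h := indep_iSup_of_disjoint (fun s => (hZ s).comap_le) hindep
    (S := Set.Iic t) (T := {t + 1}) (by simp)
  rw [IndepFun_iff_Indep]
  refine indep_of_indep_of_le_left (indep_of_indep_of_le_right h ?_) hY.comap_le
  exact le_iSup₂_of_le (t + 1) rfl le_rfl

theorem measurable_iSup_comap {Ω 𝒵 : Type*} [MeasurableSpace 𝒵] (Z : ℕ → Ω → 𝒵) {s t : ℕ}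
    (hst : s ≤ t) :
    Measurable[⨆ s ∈ Set.Iic t, MeasurableSpace.comap (Z s) inferInstance] (Z s) :=
  Measurable.mono (comap_measurable (Z s)) (le_iSup₂_of_le s hst le_rfl) le_rfl

/-- The constant in the bound `∑ E‖V̂_t^{-1/4} ∇f(x_t)‖² ≤ K √(Td)`. -/
noncomputable def rateConst (Lg L c D β : ℝ) : ℝ :=
  (D + 2 * L + 1 / c * L / 2 + (1 / c) ^ 2 / 2
    + (5 / 2 * Lg * (1 / c) ^ 2 + 1 / c * L / 2) * (6 * L ^ 2 + Lg ^ 2 / 2)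
    + L ^ 2 * (6 * L ^ 2 + Lg ^ 2 / 2) / 2) / (1 - β) ^ 2 + Lg * (1 / c) * L / 2

theorem rateConst_nonneg {Lg L c D β : ℝ} (hLg : 0 ≤ Lg) (hL : 0 ≤ L) (hc : 0 < c) (hD : 0 ≤ D) :
    0 ≤ rateConst Lg L c D β := by
  unfold rateConst; positivity

theorem sub_le_of_smoothing_sub_le {d : ℕ} {f : Vec d → ℝ} {L : ℝ≥0} (hf : LipschitzWith L f)
    {μ D : ℝ} (hμ : 0 ≤ μ) (hμ1 : μ ≤ 1) {x y : Vec d} (h : smoothing μ f x - smoothing μ f y ≤ D) :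
    f x - f y ≤ D + 2 * L := by
  have h1 := abs_le.1 (abs_smoothing_sub_le hf hμ x)
  have h2 := abs_le.1 (abs_smoothing_sub_le hf hμ y)
  have h3 : L * μ ≤ L := mul_le_of_le_one_right L.2 hμ1
  linarith

theorem integral_const_add_add {Ω : Type*} [MeasurableSpace Ω] {P : Measure Ω}
    [IsProbabilityMeasure P] (A : ℝ) {b c : Ω → ℝ} (hb : Integrable b P) (hc : Integrable c P) :
    ∫ ω, (A + b ω + c ω) ∂P = A + ∫ ω, b ω ∂P + ∫ ω, c ω ∂P := by
  have h : Integrable (fun ω => A + b ω) P := (integrable_const A).add hb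
  rw [integral_add h hc, integral_add (integrable_const A) hb]
  simp

theorem sum_integral_gradMeasure_le {L_g L_c : ℝ≥0} {c D_f β α : ℝ} (hc : 0 < c)
    (hβ : 0 ≤ β) (hβ1 : β < 1) {d T : ℕ} (hd : 1 ≤ d) (hT : 1 ≤ T)
    {Ξ : Type*} [MeasurableSpace Ξ] {ν : Measure Ξ} [IsProbabilityMeasure ν]
    {F : Vec d → Ξ → ℝ} (hint : ∀ x, Integrable (F x) ν) (hmeas : ∀ x, Measurable (F x))
    (hdiff : ∀ s, Differentiable ℝ fun x => F x s)
    (hgrad : ∀ s, LipschitzWith L_g (gradient fun x => F x s))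
    (hlip : ∀ s, LipschitzWith L_c fun x => F x s)
    {I : AdaMMInput d} (hα : α = 1 / √(T * d)) (hIμ : I.μ = α) (hIα : ∀ t, I.α t = α)
    (hIβ : ∀ t, I.β₁ t = β) (hI : ∀ i, c ≤ √(I.vhat₀ i))
    (hDf : ∀ x, smoothing I.μ (objective ν F) I.x₁ - smoothing I.μ (objective ν F) x ≤ D_f)
    {Ω : Type*} [MeasurableSpace Ω] {P : Measure Ω} [IsProbabilityMeasure P]
    {ξ : ℕ → Ω → Ξ} {u : ℕ → Ω → Vec d} (hξ : ∀ t, Measurable (ξ t)) (hu : ∀ t, Measurable (u t))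
    (hlaw : ∀ t, P.map (fun ω => (ξ t ω, u t ω)) = ν.prod (uniformSphere d))
    (hu1 : ∀ t, ∀ᵐ ω ∂P, ‖u t ω‖ = 1)
    (hindep : iIndepFun (fun t ω => (ξ t ω, u t ω)) P) :
    ∑ t ∈ Finset.range T, ∫ ω, I.gradMeasure F (objective ν F) (fun t => ξ t ω)
      (fun t => u t ω) (t + 1) ∂P ≤ rateConst L_g L_c c D_f β / α := by
  set f := objective ν F with hfdef
  have hfd : Differentiable ℝ f := differentiable_objective hint hmeas hdiff hlip
  have hfg : LipschitzWith L_g (gradient f) :=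
    lipschitzWith_gradient_objective hint hmeas hdiff hgrad hlip
  have hfl : LipschitzWith L_c f := lipschitzWith_objective hint hlip
  have hgm : Measurable (gradient f) := hfg.continuous.measurable
  have hF := measurable_uncurry_of_lipschitz hmeas hlip
  have hd0 : (0 : ℝ) < d := by positivity
  have hT0 : (0 : ℝ) < T := by positivity
  have hd1 : (1 : ℝ) ≤ d := by exact_mod_cast hd
  have hT1 : (1 : ℝ) ≤ T := by exact_mod_cast hT
  have hα0 : 0 < α := by rw [hα]; positivity
  have hα2 : α ^ 2 * (T * d) = 1 := by
    rw [hα, div_pow, Real.sq_sqrt (by positivity)]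
    field_simp
  have hα1 : α ≤ 1 := by
    have : 1 ≤ (T : ℝ) * d := by nlinarith
    nlinarith
  have hμ0 : 0 < I.μ := hIμ ▸ hα0
  have hDf0 : 0 ≤ D_f := by simpa using hDf I.x₁
  let N : ℕ → Ω → Vec d := fun t ω =>
    gradient f (I.iterate F (fun t => ξ t ω) (fun t => u t ω) (t + 1))
  let w : ℕ → Ω → Vec d := fun t ω => WithLp.toLp 2 fun i =>
      I.scaling F (fun t => ξ t ω) (fun t => u t ω) t i * N t ω i
  let g : ℕ → Ω → Vec d := fun t ω => I.ghat F (fun t => ξ t ω) (fun t => u t ω) (t + 1)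
  let X : ℕ → Ω → Vec d := fun t ω => I.iterate F (fun t => ξ t ω) (fun t => u t ω) (t + 1)
  let e : Vec d := WithLp.toLp 2 fun _ => 1
  have hXm : ∀ t, Measurable (X t) := fun t =>
    I.measurable_iterate_succ hF t (fun s _ => hξ s) (fun s _ => hu s)
  have hNm : ∀ t, Measurable (N t) := fun t => hgm.comp (hXm t)
  have hwm : ∀ t, Measurable (w t) := fun t =>
    I.measurable_scaling_mul_gradient hF hgm t (fun s _ => hξ s) (fun s _ => hu s)
  have hNb : ∀ t ω, ‖N t ω‖ ≤ L_c := fun t ω => hfl.norm_gradient_le _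
  have hwb : ∀ t ω, ‖w t ω‖ ≤ 1 / c * L_c := fun t ω =>
    (AdaMMInput.norm_scaling_mul_le F _ _ hc hI t (N t ω)).trans (by
      have := hNb t ω
      gcongr)
  have heb : ‖e‖ ^ 2 = d := by rw [EuclideanSpace.real_norm_sq_eq]; simp [e]
  have hZ : ∀ t, Measurable fun ω => (ξ t ω, u t ω) := fun t => (hξ t).prodMk (hu t)
  -- The history up to time t. The iterate x_{t+1} and the weights N_t and D_t N_t are measurable
  -- for it, hence independent of the noise at time t+1.
  let 𝓕 : ℕ → MeasurableSpace Ω := fun t =>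
    ⨆ s ∈ Set.Iic t, MeasurableSpace.comap (fun ω => (ξ s ω, u s ω)) inferInstance
  have hξF : ∀ t, ∀ s ≤ t, Measurable[𝓕 t] (ξ s) := fun t s hs =>
    measurable_fst.comp (measurable_iSup_comap (fun s ω => (ξ s ω, u s ω)) hs)
  have huF : ∀ t, ∀ s ≤ t, Measurable[𝓕 t] (u s) := fun t s hs =>
    measurable_snd.comp (measurable_iSup_comap (fun s ω => (ξ s ω, u s ω)) hs)
  have hXF : ∀ t, Measurable[𝓕 t] (X t) := fun t =>
    @AdaMMInput.measurable_iterate_succ d Ξ _ I F hF Ω (𝓕 t) ξ u t (hξF t) (huF t)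
  have hNF : ∀ t, Measurable[𝓕 t] (N t) := fun t => hgm.comp (hXF t)
  have hwF : ∀ t, Measurable[𝓕 t] (w t) := fun t =>
    @AdaMMInput.measurable_scaling_mul_gradient d Ξ _ I F hF f hgm Ω (𝓕 t) ξ u t (hξF t) (huF t)
  have hind : ∀ t (v : Ω → Vec d), Measurable[𝓕 t] v →
      IndepFun (fun ω => (X t ω, v ω)) (fun ω => (ξ (t + 1) ω, u (t + 1) ω)) P := fun t v hv =>
    indepFun_of_measurable_past hZ hindep t ((hXF t).prodMk hv)
  set K : ℝ := 6 * (L_c : ℝ) ^ 2 + L_g ^ 2 / 2 with hK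
  have hK0 : 0 ≤ K := by positivity
  -- Here dμ² = 1/T ≤ 1.
  have hKle : 6 * (L_c : ℝ) ^ 2 + d * I.μ ^ 2 * L_g ^ 2 / 2 ≤ K := by
    have : d * I.μ ^ 2 ≤ 1 := by rw [hIμ]; nlinarith [mul_pos hd0 (pow_pos hα0 2)]
    have : d * I.μ ^ 2 * (L_g : ℝ) ^ 2 ≤ 1 * (L_g : ℝ) ^ 2 := by gcongr
    linarith
  have hgsq : ∀ t, ∫ ω, ∑ i, (1 * g t ω i) ^ 2 ∂P ≤ K * d := fun t => by
    have h := integral_sum_mul_zoGrad_sq_le hd hμ0 hmeas hdiff hgrad hlip (hXm t)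
      (w := fun _ => e) measurable_const (hξ (t + 1)) (hu (t + 1)) (hlaw (t + 1))
      (hind t _ measurable_const) (hu1 (t + 1)) (fun _ => le_rfl)
    rw [heb] at h
    exact h.trans (by gcongr)
  have hqsq : ∀ t, ∫ ω, ∑ i, (N t ω i * g t ω i) ^ 2 ∂P ≤ K * L_c ^ 2 := fun t => by
    have h := integral_sum_mul_zoGrad_sq_le hd hμ0 hmeas hdiff hgrad hlip (hXm t)
      (w := N t) (hNm t) (hξ (t + 1)) (hu (t + 1)) (hlaw (t + 1))
      (hind t _ (hNF t)) (hu1 (t + 1)) (hNb t)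
    exact h.trans (by gcongr)
  have hgI : ∀ t, Integrable (fun ω => ∑ i, (1 * g t ω i) ^ 2) P := fun t =>
    integrable_sum_mul_zoGrad_sq hμ0 hmeas hlip (hXm t) (w := fun _ => e) measurable_const
      (hξ (t + 1)) (hu (t + 1)) (hu1 (t + 1)) (fun _ => le_rfl)
  have hqI : ∀ t, Integrable (fun ω => ∑ i, (N t ω i * g t ω i) ^ 2) P := fun t =>
    integrable_sum_mul_zoGrad_sq hμ0 hmeas hlip (hXm t) (hNm t)
      (hξ (t + 1)) (hu (t + 1)) (hu1 (t + 1)) (hNb t)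
  have hpI : ∀ t, Integrable (fun ω => inner ℝ (w t ω) (g t ω)) P := fun t =>
    integrable_inner_zoGrad hμ0 hmeas hlip (hXm t) (hwm t)
      (hξ (t + 1)) (hu (t + 1)) (hu1 (t + 1)) (hwb t)
  have hstep : ∀ t, ∫ ω, I.gradMeasure F f (fun t => ξ t ω) (fun t => u t ω) (t + 1) ∂P
      ≤ ∫ ω, inner ℝ (w t ω) (g t ω) ∂P + d * α * L_g / 2 * (1 / c * L_c) := fun t => by
    have h : ∫ ω, inner ℝ (w t ω) (gradient f (X t ω)) ∂P - d * I.μ * L_g / 2 * (1 / c * L_c)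
        ≤ ∫ ω, inner ℝ (w t ω) (g t ω) ∂P := integral_inner_gradient_sub_le hd hμ0 hint hmeas hdiff hgrad hlip (hXm t)
      (hwm t) (hξ (t + 1)) (hu (t + 1)) (hlaw (t + 1)) (hind t _ (hwF t)) (hu1 (t + 1)) (hwb t)
    rw [hIμ] at h
    have h2 : ∫ ω, I.gradMeasure F f (fun t => ξ t ω) (fun t => u t ω) (t + 1) ∂P
        ≤ ∫ ω, inner ℝ (w t ω) (gradient f (X t ω)) ∂P := by
      refine integral_mono ?_ ?_ fun ω => AdaMMInput.gradMeasure_succ_le F _ _ hc hI f t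
      · refine Integrable.of_bound (C := 1 / c * L_c ^ 2)
          (I.measurable_gradMeasure hF hgm hξ hu (t + 1)).aestronglyMeasurable
          (Filter.Eventually.of_forall fun ω => ?_)
        rw [Real.norm_of_nonneg (I.gradMeasure_nonneg F f _ _ _)]
        exact AdaMMInput.gradMeasure_le F hfl _ _ hc hI _
      · refine Integrable.of_bound (C := 1 / c * L_c * L_c)
          ((hwm t).inner (hNm t)).aestronglyMeasurable
          (Filter.Eventually.of_forall fun ω => (norm_inner_le_norm _ _).trans ?_)
        have := hwb t ω
        have := hNb t ω
        gcongr
    linarith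
  -- The Young weight λ = 1/(αd) balances the two sides: λB²d/2 becomes B²/(2α), and TKL_c²/(2λ)
  -- becomes KL_c²/(2α) because α²Td = 1.
  have hlam : 0 < 1 / (α * d) := by positivity
  set A : ℝ := (D_f + 2 * L_c) / α + 1 / c * L_c / 2 / α + 1 / (α * d) * (1 / c) ^ 2 * d / 2 with hA
  set B : ℝ := (5 / 2 * L_g * (1 / c) ^ 2 + 1 / c * L_c / 2) * α with hB
  set C : ℝ := 1 / (2 * (1 / (α * d))) with hC
  have hB0 : 0 ≤ B := by positivity
  have hC0 : 0 ≤ C := by positivity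
  have hpath : ∀ ω, (1 - β) ^ 2 * ∑ t ∈ Finset.range T, inner ℝ (w t ω) (g t ω) ≤
      A + B * ∑ t ∈ Finset.range T, ∑ i, (1 * g t ω i) ^ 2
        + C * ∑ t ∈ Finset.range T, ∑ i, (N t ω i * g t ω i) ^ 2 := by
    intro ω
    have h := AdaMMInput.sum_inner_ghat_le F (fun t => ξ t ω) (fun t => u t ω) hfd hfg hfl hα0 hβ
      hβ1 hlam hc hI hIα hIβ T
    refine h.trans ?_
    have h1 : f I.x₁ - f (I.iterate F (fun t => ξ t ω) (fun t => u t ω) (T + 1))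
        ≤ D_f + 2 * L_c := sub_le_of_smoothing_sub_le hfl hμ0.le (hIμ ▸ hα1) (hDf _)
    have h2 : (f I.x₁ - f (I.iterate F (fun t => ξ t ω) (fun t => u t ω) (T + 1))) * (1 - β) ^ 2
        ≤ D_f + 2 * L_c := by
      calc _ ≤ (D_f + 2 * L_c) * (1 - β) ^ 2 := by gcongr
        _ ≤ _ := mul_le_of_le_one_right (by positivity) (by nlinarith)
    have h3 : (f I.x₁ - f (I.iterate F (fun t => ξ t ω) (fun t => u t ω) (T + 1))) * (1 - β) ^ 2 / α
        ≤ (D_f + 2 * L_c) / α := by gcongr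
    rw [hA]
    gcongr
  have hE : (1 - β) ^ 2 * ∑ t ∈ Finset.range T, ∫ ω, inner ℝ (w t ω) (g t ω) ∂P ≤
      A + B * (T * (K * d)) + C * (T * (K * L_c ^ 2)) := by
    have hb := (integrable_finsetSum (Finset.range T) fun t _ => hgI t).const_mul B
    have hc' := (integrable_finsetSum (Finset.range T) fun t _ => hqI t).const_mul C
    have h := (integral_mono (μ := P)
      ((integrable_finsetSum (Finset.range T) fun t _ => hpI t).const_mul ((1 - β) ^ 2))
      (((integrable_const A).add hb).add hc') hpath).trans_eq (integral_const_add_add A hb hc')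
    rw [integral_const_mul, integral_finsetSum _ fun t _ => hpI t,
      integral_const_mul, integral_const_mul,
      integral_finsetSum _ fun t _ => hgI t, integral_finsetSum _ fun t _ => hqI t] at h
    have h1 := Finset.sum_le_sum fun t (_ : t ∈ Finset.range T) => hgsq t
    have h2 := Finset.sum_le_sum fun t (_ : t ∈ Finset.range T) => hqsq t
    simp only [Finset.sum_const, Finset.card_range, nsmul_eq_mul] at h1 h2
    refine h.trans ?_
    gcongr
  -- The remaining errors, including the bias, are O(αd) per step; over T steps they add up to
  -- O(1/α).
  have hαT : α * T * d = 1 / α := by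
    rw [eq_div_iff hα0.ne']; linarith
  have hsum : A + B * (T * (K * d)) + C * (T * (K * L_c ^ 2)) =
      (D_f + 2 * L_c + 1 / c * L_c / 2 + (1 / c) ^ 2 / 2
        + (5 / 2 * L_g * (1 / c) ^ 2 + 1 / c * L_c / 2) * K + L_c ^ 2 * K / 2) / α := by
    have hC' : C = α * d / 2 := by rw [hC]; field_simp
    have e1 : B * (T * (K * d)) = (5 / 2 * L_g * (1 / c) ^ 2 + 1 / c * L_c / 2) * K * (α * T * d) := by
      rw [hB]; ring
    have e2 : C * (T * (K * L_c ^ 2)) = L_c ^ 2 * K / 2 * (α * T * d) := by rw [hC']; ring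
    rw [e1, e2, hαT, hA]
    field_simp
  have h1β : 0 < (1 - β) ^ 2 := by have : 0 < 1 - β := by linarith
                                   positivity
  rw [hsum, mul_comm, ← le_div_iff₀ h1β] at hE
  have hfin := Finset.sum_le_sum fun t (_ : t ∈ Finset.range T) => hstep t
  rw [Finset.sum_add_distrib, Finset.sum_const, Finset.card_range, nsmul_eq_mul] at hfin
  have e3 : (T : ℝ) * (d * α * L_g / 2 * (1 / c * L_c)) = L_g * (1 / c) * L_c / 2 * (α * T * d) := by
    ring
  rw [e3, hαT] at hfin
  refine hfin.trans ?_
  have e4 : rateConst L_g L_c c D_f β / α = (D_f + 2 * L_c + 1 / c * L_c / 2 + (1 / c) ^ 2 / 2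
        + (5 / 2 * L_g * (1 / c) ^ 2 + 1 / c * L_c / 2) * K + L_c ^ 2 * K / 2) / α / (1 - β) ^ 2
        + L_g * (1 / c) * L_c / 2 * (1 / α) := by
    rw [rateConst, hK]
    ring
  rw [e4]
  linarith

/-! ### The random index, conditioning, and the probability of U. -/

theorem integral_uniformOn_Icc (T : ℕ) (h : ℕ → ℝ) :
    ∫ t, h t ∂(uniformOn (Set.Icc 1 T)) = 1 / T * ∑ t ∈ Finset.range T, h (t + 1) := by
  have hfin : Integrable h (Measure.count.restrict (Finset.Icc 1 T : Set ℕ)) := by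
    have : IsFiniteMeasure (Measure.count.restrict (Finset.Icc 1 T : Set ℕ)) :=
      ⟨by rw [Measure.restrict_apply_univ, Measure.count_apply_finset]; simp⟩
    have h1 : IntegrableOn h (Finset.Icc 1 T : Set ℕ)
        (Measure.count.restrict (Finset.Icc 1 T : Set ℕ)) :=
      IntegrableOn.of_finite (Finset.finite_toSet _)
    rwa [IntegrableOn, Measure.restrict_restrict (Finset.measurableSet _), Set.inter_self] at h1
  rw [uniformOn, ProbabilityTheory.cond, integral_smul_measure, ← Finset.coe_Icc,
    setIntegral_finset _ hfin, Measure.count_apply_finset]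
  simp only [Nat.card_Icc, Nat.add_sub_cancel, measureReal_def, Measure.count_singleton,
    ENNReal.toReal_one, one_mul, ENNReal.toReal_inv, ENNReal.toReal_natCast, smul_eq_mul, one_div]
  rw [Finset.range_eq_Ico, Finset.sum_Ico_add' h 0 T 1, zero_add, ← Finset.Ico_add_one_right_eq_Icc]

/-- Independence of the index from the whole noise sequence allows the noise to be integrated out at
a frozen index, leaving a uniform average. -/
theorem integral_comp_index {Ω 𝒵 : Type*} [MeasurableSpace Ω] [MeasurableSpace 𝒵]
    {P : Measure Ω} [IsProbabilityMeasure P] {R : Ω → ℕ} {Z : Ω → 𝒵} (hR : Measurable R)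
    (hZ : Measurable Z) (hindep : IndepFun R Z P) {T : ℕ}
    (hlaw : P.map R = uniformOn (Set.Icc 1 T)) {Ψ : ℕ → 𝒵 → ℝ} (hΨ : ∀ t, Measurable (Ψ t))
    {M : ℝ} (hM : ∀ t z, |Ψ t z| ≤ M) :
    Integrable (fun ω => Ψ (R ω) (Z ω)) P ∧
      ∫ ω, Ψ (R ω) (Z ω) ∂P = 1 / T * ∑ t ∈ Finset.range T, ∫ ω, Ψ (t + 1) (Z ω) ∂P := by
  have hm : Measurable fun p : ℕ × 𝒵 => Ψ p.1 p.2 := measurable_from_prod_countable_right hΨ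
  have hint : Integrable (fun ω => Ψ (R ω) (Z ω)) P :=
    Integrable.of_bound (C := M) (hm.comp (hR.prodMk hZ)).aestronglyMeasurable
      (Filter.Eventually.of_forall fun ω => hM _ _)
  refine ⟨hint, ?_⟩
  have h := (integral_comp_prodMk_of_indepFun hR hZ hindep hm hint).2
  rw [h, ← integral_map (f := fun t => ∫ z, Ψ t z ∂P.map Z) hR.aemeasurable
    (Measurable.of_discrete).aestronglyMeasurable, hlaw, integral_uniformOn_Icc]
  simp_rw [integral_map hZ.aemeasurable (hΨ _).aestronglyMeasurable]

/-- For a nonnegative variable, dropping the restriction to U only increases the integral, so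
conditioning costs the normalization alone. -/
theorem integral_cond_le {Ω : Type*} [MeasurableSpace Ω] {P : Measure Ω} [IsProbabilityMeasure P]
    {X : Ω → ℝ} (hX : Integrable X P) (hX0 : ∀ ω, 0 ≤ X ω) (U : Set Ω) {p : ℝ} (hp : 0 < p)
    (hU : p ≤ P.real U) :
    Integrable X P[|U] ∧ ∫ ω, X ω ∂P[|U] ≤ 1 / p * ∫ ω, X ω ∂P := by
  have hU0 : P U ≠ 0 := fun h => by
    rw [measureReal_def, h] at hU
    simp at hU
    linarith
  refine ⟨hX.restrict.smul_measure (by simpa using hU0), ?_⟩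
  rw [ProbabilityTheory.cond, integral_smul_measure, ENNReal.toReal_inv, ← measureReal_def,
    smul_eq_mul, ← one_div]
  have h0 : 0 ≤ ∫ ω, X ω ∂P := integral_nonneg hX0
  have h1 : ∫ ω in U, X ω ∂P ≤ ∫ ω, X ω ∂P :=
    setIntegral_le_integral hX (Filter.Eventually.of_forall hX0)
  have h2 : 1 / P.real U ≤ 1 / p := one_div_le_one_div_of_le hp hU
  calc _ ≤ 1 / P.real U * ∫ ω, X ω ∂P := by gcongr
    _ ≤ _ := by gcongr

theorem le_measureReal_estimatesBounded {d T : ℕ} (hd : 1 ≤ d) (hT : 1 ≤ T) (hdT : 3 ≤ max d T)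
    {Ξ : Type*} {F : Vec d → Ξ → ℝ} {L : ℝ≥0} (hlip : ∀ s, LipschitzWith L fun x => F x s)
    {I : AdaMMInput d} (hμ : 0 < I.μ)
    {Ω : Type*} [MeasurableSpace Ω] {P : Measure Ω} [IsProbabilityMeasure P]
    {ξ : ℕ → Ω → Ξ} {u : ℕ → Ω → Vec d} (hu : ∀ t, Measurable (u t))
    (hlaw : ∀ t, P.map (u t) = uniformSphere d) (hu1 : ∀ t, ∀ᵐ ω ∂P, ‖u t ω‖ = 1) :
    1 - 1 / (T * √d) ≤ P.real {ω | EstimatesBounded I F T L (1 / (T * √d))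
      (fun t => ξ t ω) (fun t => u t ω)} := by
  set U := {ω | EstimatesBounded I F T L (1 / (T * √d)) (fun t => ξ t ω) (fun t => u t ω)} with hU
  have hd1 : (1 : ℝ) ≤ d := by exact_mod_cast hd
  have hT1 : (1 : ℝ) ≤ T := by exact_mod_cast hT
  have hd0 : (0 : ℝ) < d := by positivity
  have hT0 : (0 : ℝ) < T := by positivity
  have hsd : 0 < √(d : ℝ) := Real.sqrt_pos.2 hd0
  have hsd1 : 1 ≤ √(d : ℝ) := Real.one_le_sqrt.2 hd1
  have hsd2 : √(d : ℝ) ^ 2 = d := Real.sq_sqrt hd0.le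
  set Λ : ℝ := d * T / (1 / (T * √d)) with hΛ
  have hΛ' : Λ = T ^ 2 * (√d * √d * √d) := by
    rw [hΛ, div_div_eq_mul_div, div_one, ← sq, hsd2]
    ring
  -- This is where max{d,T} ≥ 3 enters: √Λ ≥ 2 will absorb the factor 2 of the two-sided tail.
  have hΛ4 : 4 ≤ Λ := by
    rw [hΛ']
    rcases le_max_iff.1 hdT with h | h
    · have h3 : (3 : ℝ) ≤ d := by exact_mod_cast h
      have h4 : (3 : ℝ) / 2 ≤ √d := by
        rw [Real.le_sqrt' (by norm_num)]
        norm_num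
        linarith
      have h5 : √(d : ℝ) * √d = d := by rw [← sq, hsd2]
      rw [h5]
      have h6 : 4 ≤ d * √(d : ℝ) := by nlinarith
      nlinarith [one_le_pow₀ hT1 (n := 2)]
    · have h3 : (3 : ℝ) ≤ T := by exact_mod_cast h
      have : 1 ≤ √(d : ℝ) * √d * √d := by
        rw [show √(d : ℝ) * √d * √d = √d ^ 3 by ring]
        exact one_le_pow₀ hsd1
      nlinarith
  have hΛ0 : 0 < Λ := by linarith
  have hlog : 0 ≤ Real.log Λ := Real.log_nonneg (by linarith)
  -- Chosen so that d L s equals the threshold in U. Then ds² = 4 log Λ, and the tail exponent 3/8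
  -- gives 2Λ^{-3/2} ≤ 1/Λ.
  set s : ℝ := 2 * √(Real.log Λ / d) with hs
  have hs0 : 0 ≤ s := by positivity
  have hs2 : d * s ^ 2 = 4 * Real.log Λ := by
    rw [hs, mul_pow, Real.sq_sqrt (by positivity)]
    field_simp
    ring
  let B : ℕ → Fin d → Set Ω := fun t i => {ω | s < |u t ω i|}
  have hcover : (Set.univ : Set Ω) ⊆ (U ∪ ⋃ t ∈ Finset.Icc 1 T, ⋃ i, B t i)
      ∪ {ω | ¬ ∀ t, ‖u t ω‖ = 1} := by
    intro ω _
    by_cases h1 : ∀ t, ‖u t ω‖ = 1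
    · left
      by_cases h2 : ω ∈ ⋃ t ∈ Finset.Icc 1 T, ⋃ i, B t i
      · exact Or.inr h2
      · left
        simp only [Set.mem_iUnion, not_exists] at h2
        intro t ht
        rw [pi_norm_le_iff_of_nonneg (by positivity)]
        intro i
        have h3 : |u t ω i| ≤ s := not_lt.1 (h2 t ht i)
        rw [Real.norm_eq_abs]
        calc _ ≤ d * L * |u t ω i| :=
              abs_zoGrad_apply_le hμ (hlip (ξ t ω)) _ (h1 t) i
          _ ≤ d * L * s := by gcongr
          _ = 2 * L * (d * √(Real.log Λ / d)) := by rw [hs]; ring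
          _ = 2 * L * √(d * Real.log Λ) := by
              congr 1
              rw [show (d : ℝ) * Real.log Λ = d ^ 2 * (Real.log Λ / d) by field_simp,
                Real.sqrt_mul (by positivity), Real.sqrt_sq hd0.le]
    · exact Or.inr h1
  have hnull : P.real {ω | ¬ ∀ t, ‖u t ω‖ = 1} = 0 := by
    have := ae_all_iff.2 hu1
    rw [measureReal_def, ae_iff.1 this, ENNReal.toReal_zero]
  have hB : ∀ t i, P.real (B t i) ≤ 1 / (T * d * (T * √d)) := by
    intro t i
    have h1 : P.real (B t i) = (uniformSphere d).real {u | s < |u i|} := by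
      rw [measureReal_def, measureReal_def, ← hlaw t,
        Measure.map_apply (hu t) (measurableSet_lt measurable_const (by fun_prop))]
      rfl
    rw [h1]
    refine (uniformSphere_lt_abs_coord_le hd i hs0).trans ?_
    have hexp : Real.exp (-(3 / 8) * (d * s ^ 2)) = 1 / (Λ * √Λ) := by
      have : Λ * √Λ = Real.exp (3 / 2 * Real.log Λ) := by
        rw [show 3 / 2 * Real.log Λ = Real.log Λ + Real.log Λ / 2 by ring, Real.exp_add,
          Real.exp_log hΛ0, ← Real.log_sqrt hΛ0.le, Real.exp_log (Real.sqrt_pos.2 hΛ0)]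
      rw [this, one_div, ← Real.exp_neg, hs2]
      congr 1
      ring
    have h2 : 2 ≤ √Λ := by
      rw [Real.le_sqrt' (by norm_num)]
      norm_num
      exact hΛ4
    have h3 : T * d * (T * √d) = Λ := by rw [hΛ]; field_simp
    rw [hexp, h3, mul_one_div, div_le_div_iff₀ (by positivity) hΛ0]
    nlinarith
  have hunion : P.real (⋃ t ∈ Finset.Icc 1 T, ⋃ i, B t i) ≤ 1 / (T * √d) := by
    calc _ ≤ ∑ t ∈ Finset.Icc 1 T, P.real (⋃ i, B t i) := measureReal_biUnion_finset_le _ _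
      _ ≤ ∑ t ∈ Finset.Icc 1 T, ∑ i : Fin d, P.real (B t i) := by
          gcongr with t
          exact measureReal_iUnion_fintype_le _
      _ ≤ ∑ t ∈ Finset.Icc 1 T, ∑ i : Fin d, 1 / (T * d * (T * √d)) := by
          gcongr with t _ i
          exact hB t i
      _ = _ := by
          simp
          field_simp
  -- Subadditivity over a cover of the whole space, which does not require U to be measurable.
  have htot : (1 : ℝ) ≤ P.real U + 1 / (T * √d) := by
    calc (1 : ℝ) = P.real Set.univ := by simp
      _ ≤ _ := measureReal_mono hcover
      _ ≤ _ := measureReal_union_le _ _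
      _ ≤ (P.real U + P.real (⋃ t ∈ Finset.Icc 1 T, ⋃ i, B t i)) + 0 := by
          rw [hnull]
          gcongr
          exact measureReal_union_le _ _
      _ ≤ _ := by linarith
  linarith

/-! ### The theorem. -/

theorem theorem1
    (L_g L_c : ℝ≥0) (hLg : 0 < L_g)
    (c D_f β₁ β₂ : ℝ) (hc : 0 < c)
    (hβ₁ : 0 ≤ β₁) (hβ₂_pos : 0 < β₂) (hβ₂_le : β₂ ≤ 1) (hγ : β₁ / β₂ < 1) :
    ∃ C : ℝ, 0 < C ∧
      ∀ (d T : ℕ), 1 ≤ d → 1 ≤ T → 3 ≤ max d T →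
      -- the stochastic loss and the law of its sample
      ∀ (Ξ : Type*) [MeasurableSpace Ξ] (ν : Measure Ξ) [IsProbabilityMeasure ν]
        (F : Vec d → Ξ → ℝ),
        (∀ x, Integrable (F x) ν) →
        (∀ x, Measurable (F x)) →
        (∀ s, Differentiable ℝ fun x => F x s) →
        (∀ s, LipschitzWith L_g (gradient fun x => F x s)) →
        (∀ s, LipschitzWith L_c fun x => F x s) →
      -- the input of the algorithm
      ∀ I : AdaMMInput d,
        I.μ = 1 / √(T * d) →
        (∀ t, I.α t = 1 / √(T * d)) →
        (∀ t, I.β₁ t = β₁) →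
        I.β₂ = β₂ →
        (∀ i, c ≤ √(I.vhat₀ i)) →
        (∀ x, smoothing I.μ (objective ν F) I.x₁ - smoothing I.μ (objective ν F) x ≤ D_f) →
      -- the randomness: independent samples `ξ t`, directions `u t`, and index `R`
      ∀ (Ω : Type*) [MeasurableSpace Ω] (P : Measure Ω) [IsProbabilityMeasure P]
        (ξ : ℕ → Ω → Ξ) (u : ℕ → Ω → Vec d) (R : Ω → ℕ),
        (∀ t, Measurable (ξ t)) → (∀ t, Measurable (u t)) → Measurable R →
        (∀ t, P.map (ξ t) = ν) →
        (∀ t, P.map (u t) = uniformSphere d) →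
        P.map R = uniformOn (Set.Icc 1 T) →
        (∀ t, IndepFun (ξ t) (u t) P) →
        iIndepFun (fun t ω => (ξ t ω, u t ω)) P →
        IndepFun R (fun ω t => (ξ t ω, u t ω)) P →
      -- the high-probability event, and the rate in expectation conditioned on it
      ∀ U : Set Ω,
        U = {ω | EstimatesBounded I F T L_c (1 / (T * √d)) (fun t => ξ t ω) (fun t => u t ω)} →
        1 - 1 / (T * √d) ≤ P.real U ∧
        Integrable (fun ω =>
          I.gradMeasure F (objective ν F) (fun t => ξ t ω) (fun t => u t ω) (R ω)) P[|U] ∧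
        ∫ ω, I.gradMeasure F (objective ν F) (fun t => ξ t ω) (fun t => u t ω) (R ω) ∂P[|U]
          ≤ C * (√d / √T + (d : ℝ) ^ (3 / 2 : ℝ) / T) := by
  have hβ1 : β₁ < 1 := ((div_lt_one hβ₂_pos).1 hγ).trans_le hβ₂_le
  -- The factor 3 is the cost of conditioning, and 1 is added for strict positivity. C is fixed
  -- before any problem is given; D_f ≥ 0 follows only afterwards, from the gap hypothesis at x =
  -- x₁, hence the maximum.
  refine ⟨3 * rateConst L_g L_c c (max D_f 0) β₁ + 1, by
    have := rateConst_nonneg (β := β₁) L_g.coe_nonneg L_c.coe_nonneg hc (le_max_right D_f 0)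
    linarith, ?_⟩
  intro d T hd hT hdT Ξ _ ν _ F hint hmeas hdiff hgrad hlip I hIμ hIα hIβ _ hI hDf Ω _ P _ ξ u R
    hξ hu hR hlawξ hlawu hlawR hξu hindep hRindep U hU
  have hd1 : (1 : ℝ) ≤ d := by exact_mod_cast hd
  have hT1 : (1 : ℝ) ≤ T := by exact_mod_cast hT
  have hd0 : (0 : ℝ) < d := by positivity
  have hT0 : (0 : ℝ) < T := by positivity
  have hDf0 : 0 ≤ D_f := by simpa using hDf I.x₁
  rw [max_eq_left hDf0]
  set K := rateConst L_g L_c c D_f β₁ with hK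
  have hK0 : 0 ≤ K := rateConst_nonneg L_g.coe_nonneg L_c.coe_nonneg hc hDf0
  have hμ : 0 < I.μ := by rw [hIμ]; positivity
  have hu1 : ∀ t, ∀ᵐ ω ∂P, ‖u t ω‖ = 1 := fun t =>
    ae_of_ae_map (hu t).aemeasurable (by rw [hlawu t]; exact ae_norm_eq_one_uniformSphere d)
  have hlaw : ∀ t, P.map (fun ω => (ξ t ω, u t ω)) = ν.prod (uniformSphere d) := fun t => by
    rw [(indepFun_iff_map_prod_eq_prod_map_map (hξ t).aemeasurable (hu t).aemeasurable).1 (hξu t),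
      hlawξ, hlawu]
  have hprob := le_measureReal_estimatesBounded (ξ := ξ) hd hT hdT hlip hμ hu hlawu hu1
  rw [← hU] at hprob
  have hF := measurable_uncurry_of_lipschitz hmeas hlip
  have hgm : Measurable (gradient (objective ν F)) :=
    (lipschitzWith_gradient_objective hint hmeas hdiff hgrad hlip).continuous.measurable
  have hfl := lipschitzWith_objective hint hlip
  have hΨ : ∀ t, Measurable fun z : ℕ → Ξ × Vec d =>
      I.gradMeasure F (objective ν F) (fun t => (z t).1) (fun t => (z t).2) t := fun t =>
    I.measurable_gradMeasure hF hgm (ξ := fun t (z : ℕ → Ξ × Vec d) => (z t).1)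
      (u := fun t z => (z t).2) (fun s => measurable_fst.comp (measurable_pi_apply s))
      (fun s => measurable_snd.comp (measurable_pi_apply s)) t
  obtain ⟨hXint, hXeq⟩ := integral_comp_index (Z := fun ω t => (ξ t ω, u t ω)) hR
    (measurable_pi_lambda _ fun t => (hξ t).prodMk (hu t)) hRindep hlawR hΨ
    (M := 1 / c * L_c ^ 2) fun t z => by
      rw [abs_of_nonneg (I.gradMeasure_nonneg F _ _ _ _)]
      exact AdaMMInput.gradMeasure_le F hfl _ _ hc hI t
  have hsum := sum_integral_gradMeasure_le hc hβ₁ hβ1 hd hT hint hmeas hdiff hgrad hlip rfl hIμ hIα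
    hIβ hI hDf hξ hu hlaw hu1 hindep
  -- From max{d,T} ≥ 3 one gets T√d ≥ 3/2, so the failure probability is at most 2/3.
  have hpU : 1 / 3 ≤ P.real U := by
    refine le_trans ?_ hprob
    have h : 3 / 2 ≤ T * √(d : ℝ) := by
      rcases le_max_iff.1 hdT with h | h
      · have h3 : (3 : ℝ) ≤ d := by exact_mod_cast h
        have h4 : (3 : ℝ) / 2 ≤ √d := by
          rw [Real.le_sqrt' (by norm_num)]
          norm_num
          linarith
        nlinarith
      · have h3 : (3 : ℝ) ≤ T := by exact_mod_cast h
        nlinarith [Real.one_le_sqrt.2 hd1]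
    have := one_div_le_one_div_of_le (by norm_num) h
    rw [show (1 : ℝ) / (3 / 2) = 2 / 3 by norm_num] at this
    linarith
  obtain ⟨h1, h2⟩ := integral_cond_le hXint (fun ω => I.gradMeasure_nonneg F _ _ _ _) U
    (by norm_num) hpU
  refine ⟨hprob, h1, h2.trans ?_⟩
  rw [hXeq]
  have hrate : 1 / (T : ℝ) * (K / (1 / √(T * d))) = K * (√d / √T) := by
    have hsT : √(T : ℝ) * √T = T := Real.mul_self_sqrt hT0.le
    have hsT0 : 0 < √(T : ℝ) := Real.sqrt_pos.2 hT0
    rw [Real.sqrt_mul hT0.le, div_div_eq_mul_div, div_one]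
    nth_rewrite 1 [← hsT]
    field_simp
  have hterm : 0 ≤ (d : ℝ) ^ (3 / 2 : ℝ) / T := by positivity
  have hterm' : 0 ≤ √(d : ℝ) / √T := by positivity
  calc _ ≤ 1 / (1 / 3) * (1 / (T : ℝ) * (K / (1 / √(T * d)))) := by gcongr
    _ = 3 * K * (√d / √T) := by rw [hrate]; ring
    -- The first term of the rate already suffices; the d^{3/2}/T term is only known to be
    -- nonnegative and is added for free.
    _ ≤ _ := by nlinarith [mul_nonneg hK0 hterm]
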